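/- Let $\Bbbk$ be an algebraically closed field; all categories and functors below are $\Bbbk$-linear. A *semigroup category* is a category $\mathcal S$ with a bilinear bifunctor $\boxtimes$ and a natural associativity isomorphism $\mathsf a$ satisfying the pentagon axiom (no unit is required). An *$\mathcal S$-module category* is a category $\mathbf M$ with a bilinear bifunctor $\star:\mathcal S\times\mathbf M\to\mathbf M$ and isomorphisms $(\mathrm G\boxtimes \mathrm F)\star X\simeq \mathrm G\star(\mathrm F\star X)$, natural in all variables and satisfying the multiplicative coherence (pentagon) axiom. An *adjunction* in $\mathcal S$ consists of objects $\mathrm F,\mathrm F^{\vee}$ and natural transformations $\eta^l_X:X\to X\boxtimes(\mathrm F^{\vee}\boxtimes \mathrm F)$ and $\varepsilon^l_X:X\boxtimes(\mathrm F\boxtimes \mathrm F^{\vee})\to X$ of left $\mathcal S$-module functors, and $\eta^r_X:X\to(\mathrm F^{\vee}\boxtimes \mathrm F)\boxtimes X$ and $\varepsilon^r_X:(\mathrm F\boxtimes \mathrm F^{\vee})\boxtimes X\to X$ of right $\mathcal S$-module functors, such that, up to associators: $(-\boxtimes \mathrm F^{\vee},-\boxtimes \mathrm F,\eta^l,\varepsilon^l)$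 and $(\mathrm F\boxtimes-,\mathrm F^{\vee}\boxtimes-,\eta^r,\varepsilon^r)$ are adjunctions; $\varepsilon^r_{\mathrm F}\circ\eta^l_{\mathrm F}=\mathrm{id}_{\mathrm F}$ and $\varepsilon^l_{\mathrm F^{\vee}}\circ\eta^r_{\mathrm F^{\vee}}=\mathrm{id}_{\mathrm F^{\vee}}$; and $\mathrm H\boxtimes\eta^r_{\mathrm K}=\eta^l_{\mathrm H}\boxtimes \mathrm K$, $\mathrm H\boxtimes\varepsilon^r_{\mathrm K}=\varepsilon^l_{\mathrm H}\boxtimes \mathrm K$ for all $\mathrm H,\mathrm K\in\mathcal S$. Then $\mathrm F^{\vee}$ is a right dual of $\mathrm F$, and $\mathrm F$ is a left dual of $\mathrm F^{\vee}$. $\mathcal S$ is *rigid* if every object has a left and a right dual. A $\Bbbk$-linear category is *finitary* if it is $\Bbbk$-linearly equivalent to the category of finitely generated projective modules over some finite-dimensional $\Bbbk$-algebra; $\mathcal S$ is *quasi-fias* if it is finitary and rigid. $\mathcal S$ is *$\mathcal J$-cell-trivial* if for all $\mathrm F,\mathrm G\in\mathcal S$ with $\mathrm G\neq0$ there are $\mathrm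 H,\mathrm K\in\mathcal S$ such that $\mathrm F$ is a direct summand of $\mathrm H\boxtimes \mathrm G\boxtimes \mathrm K$. An $\mathcal S$-module category $\mathbf M$ is *simple transitive* if the only two-sided ideals $\mathbf I$ of the $\Bbbk$-linear category $\mathbf M$ with $\mathrm F\star g\in\mathbf I$ for all $\mathrm F\in\mathcal S$, $g\in\mathbf I$ are $0$ and $\mathbf M$. **Theorem.** Let $\mathcal S$ be a $\mathcal J$-cell-trivial quasi-fias semigroup category and let $\mathbf M$ be a finitary simple transitive $\mathcal S$-module category. Let $[\mathbf M^{\mathrm{op}},\mathbf{vec}_\Bbbk]$ be the category of $\Bbbk$-linear functors from $\mathbf M^{\mathrm{op}}$ to finite-dimensional $\Bbbk$-vector spaces, with the $\mathcal S$-module structure in which $\mathrm F\in\mathcal S$ acts by $(\mathrm F\star-)_!$, the left adjoint of the functor $\Phi\mapsto\Phi(\mathrm F\star-)$. Then $[\mathbf M^{\mathrm{op}},\mathbf{vec}_\Bbbk]$ is projectivizing: it is abelian, it has enough projectives, and $\mathrm F\star\Phi$ is projective for every $\mathrm F\in\mathcal S$ and every $\Phi\in[\mathbf M^{\mathrm{op}},\mathbf{vec}_\Bbbk]$.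 -/

import Mathlib

open CategoryTheory

universe w v u v₁ u₁

set_option linter.unusedSectionVars false

namespace SgCat

/-! ## Semigroup categories -/

/-- A semigroup category: a category with a tensor product (a bifunctor, given by its action on
objects and by whiskering) and an associativity isomorphism, natural in all three variables and
satisfying the pentagon axiom. No unit object is required. -/
class SemigroupCategory (S : Type u₁) [Category.{v₁} S] where
  tensorObj : S → S → S
  whiskerLeft (F : S) {G G' : S} (g : G ⟶ G') : tensorObj F G ⟶ tensorObj F G'
  whiskerRight {F F' : S} (f : F ⟶ F') (G : S) : tensorObj F G ⟶ tensorObj F' G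
  assoc (F G H : S) : tensorObj (tensorObj F G) H ≅ tensorObj F (tensorObj G H)
  whiskerLeft_id (F G : S) : whiskerLeft F (𝟙 G) = 𝟙 (tensorObj F G)
  whiskerLeft_comp (F : S) {G G' G'' : S} (g : G ⟶ G') (g' : G' ⟶ G'') :
    whiskerLeft F (g ≫ g') = whiskerLeft F g ≫ whiskerLeft F g'
  id_whiskerRight (F G : S) : whiskerRight (𝟙 F) G = 𝟙 (tensorObj F G)
  comp_whiskerRight {F F' F'' : S} (f : F ⟶ F') (f' : F' ⟶ F'') (G : S) :
    whiskerRight (f ≫ f') G = whiskerRight f G ≫ whiskerRight f' G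
  whisker_exchange {F F' G G' : S} (f : F ⟶ F') (g : G ⟶ G') :
    whiskerLeft F g ≫ whiskerRight f G' = whiskerRight f G ≫ whiskerLeft F' g
  assoc_naturality_left {F F' : S} (f : F ⟶ F') (G H : S) :
    whiskerRight (whiskerRight f G) H ≫ (assoc F' G H).hom =
      (assoc F G H).hom ≫ whiskerRight f (tensorObj G H)
  assoc_naturality_middle (F : S) {G G' : S} (g : G ⟶ G') (H : S) :
    whiskerRight (whiskerLeft F g) H ≫ (assoc F G' H).hom =
      (assoc F G H).hom ≫ whiskerLeft F (whiskerRight g H)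
  assoc_naturality_right (F G : S) {H H' : S} (h : H ⟶ H') :
    whiskerLeft (tensorObj F G) h ≫ (assoc F G H').hom =
      (assoc F G H).hom ≫ whiskerLeft F (whiskerLeft G h)
  pentagon (F G H K : S) :
    whiskerRight (assoc F G H).hom K ≫ (assoc F (tensorObj G H) K).hom ≫
        whiskerLeft F (assoc G H K).hom =
      (assoc (tensorObj F G) H K).hom ≫ (assoc F G (tensorObj H K)).hom

infixr:70 " ⊠ " => SemigroupCategory.tensorObj
infixr:81 " ◁ₛ " => SemigroupCategory.whiskerLeft
infixl:81 " ▷ₛ " => SemigroupCategory.whiskerRight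

open SemigroupCategory

/-- The tensor product of a `k`-linear semigroup category is `k`-bilinear on morphisms. -/
class SemigroupCategory.IsLinear (k : Type w) [Field k] (S : Type u₁) [Category.{v₁} S]
    [Preadditive S] [Linear k S] [SemigroupCategory S] : Prop where
  whiskerLeft_add (F : S) {G G' : S} (g h : G ⟶ G') : F ◁ₛ (g + h) = F ◁ₛ g + F ◁ₛ h
  whiskerLeft_smul (F : S) {G G' : S} (r : k) (g : G ⟶ G') : F ◁ₛ (r • g) = r • (F ◁ₛ g)
  add_whiskerRight {F F' : S} (f h : F ⟶ F') (G : S) : (f + h) ▷ₛ G = f ▷ₛ G + h ▷ₛ G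
  smul_whiskerRight {F F' : S} (r : k) (f : F ⟶ F') (G : S) : (r • f) ▷ₛ G = r • (f ▷ₛ G)

/-- An adjunction `(F, D, ηˡ, ηʳ, εˡ, εʳ)` in a semigroup category; `D` is then a right dual of `F`
and `F` is a left dual of `D`. -/
structure DualPair {S : Type u₁} [Category.{v₁} S] [SemigroupCategory S] (F D : S) where
  etaL (X : S) : X ⟶ X ⊠ (D ⊠ F)
  etaR (X : S) : X ⟶ (D ⊠ F) ⊠ X
  epsL (X : S) : X ⊠ (F ⊠ D) ⟶ X
  epsR (X : S) : (F ⊠ D) ⊠ X ⟶ X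
  etaL_naturality {X Y : S} (f : X ⟶ Y) : f ≫ etaL Y = etaL X ≫ f ▷ₛ (D ⊠ F)
  etaR_naturality {X Y : S} (f : X ⟶ Y) : f ≫ etaR Y = etaR X ≫ (D ⊠ F) ◁ₛ f
  epsL_naturality {X Y : S} (f : X ⟶ Y) : f ▷ₛ (F ⊠ D) ≫ epsL Y = epsL X ≫ f
  epsR_naturality {X Y : S} (f : X ⟶ Y) : (F ⊠ D) ◁ₛ f ≫ epsR Y = epsR X ≫ f
  /-- `ηˡ` and `εˡ` are transformations of left module functors. -/
  etaL_module (H X : S) : etaL (H ⊠ X) ≫ (assoc H X (D ⊠ F)).hom = H ◁ₛ etaL X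
  epsL_module (H X : S) : (assoc H X (F ⊠ D)).hom ≫ H ◁ₛ epsL X = epsL (H ⊠ X)
  /-- `ηʳ` and `εʳ` are transformations of right module functors. -/
  etaR_module (X H : S) : etaR X ▷ₛ H ≫ (assoc (D ⊠ F) X H).hom = etaR (X ⊠ H)
  epsR_module (X H : S) : (assoc (F ⊠ D) X H).hom ≫ epsR (X ⊠ H) = epsR X ▷ₛ H
  /-- `(- ⊠ D, - ⊠ F, ηˡ, εˡ)` is an adjunction. -/
  left_triangle₁ (X : S) :
    etaL X ▷ₛ D ≫ (assoc X D F).inv ▷ₛ D ≫ (assoc (X ⊠ D) F D).hom ≫ epsL (X ⊠ D) = 𝟙 (X ⊠ D)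
  left_triangle₂ (X : S) :
    etaL (X ⊠ F) ≫ (assoc (X ⊠ F) D F).inv ≫ (assoc X F D).hom ▷ₛ F ≫ epsL X ▷ₛ F = 𝟙 (X ⊠ F)
  /-- `(F ⊠ -, D ⊠ -, ηʳ, εʳ)` is an adjunction. -/
  right_triangle₁ (X : S) :
    F ◁ₛ etaR X ≫ F ◁ₛ (assoc D F X).hom ≫ (assoc F D (F ⊠ X)).inv ≫ epsR (F ⊠ X) = 𝟙 (F ⊠ X)
  right_triangle₂ (X : S) :
    etaR (D ⊠ X) ≫ (assoc D F (D ⊠ X)).hom ≫ D ◁ₛ (assoc F D X).inv ≫ D ◁ₛ epsR X = 𝟙 (D ⊠ X)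
  /-- The mixed zigzag equations. -/
  zigzag₁ : etaL F ≫ (assoc F D F).inv ≫ epsR F = 𝟙 F
  zigzag₂ : etaR D ≫ (assoc D F D).hom ≫ epsL D = 𝟙 D
  /-- Left-right compatibility. -/
  eta_compat (H K : S) : H ◁ₛ etaR K ≫ (assoc H (D ⊠ F) K).inv = etaL H ▷ₛ K
  eps_compat (H K : S) : (assoc H (F ⊠ D) K).hom ≫ H ◁ₛ epsR K = epsL H ▷ₛ K

/-- A semigroup category is rigid if every object has a right dual and a left dual. -/
class IsRigid (S : Type u₁) [Category.{v₁} S] [SemigroupCategory S] : Prop where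
  exists_rightDual (F : S) : ∃ D : S, Nonempty (DualPair F D)
  exists_leftDual (F : S) : ∃ D : S, Nonempty (DualPair D F)

/-- The category `A-proj` of finitely generated projective left `A`-modules. -/
abbrev FinProj (A : Type v) [Ring A] :=
  ObjectProperty.FullSubcategory
    (fun X : ModuleCat.{v} A => Module.Finite A X ∧ Module.Projective A X)

/-- A `k`-linear category is finitary if it is `k`-linearly equivalent to `A-proj` for some
finite-dimensional `k`-algebra `A`. (Such an `A` is an endomorphism algebra in the category, so it
can be taken in the universe of its morphisms.) -/
class IsFinitary (k : Type w) [Field k] (C : Type u) [Category.{v} C] [Preadditive C]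
    [Linear k C] : Prop where
  exists_equivalence : ∃ (A : Type v) (_ : Ring A) (_ : Algebra k A) (_ : Module.Finite k A)
    (e : C ≌ FinProj A), e.functor.Additive ∧ e.functor.Linear k

/-- A semigroup category is quasi-fias if it is finitary and rigid. -/
class IsQuasiFias (k : Type w) [Field k] (S : Type u₁) [Category.{v₁} S] [Preadditive S]
    [Linear k S] [SemigroupCategory S] : Prop extends IsFinitary k S, IsRigid S

/-- `S` is J-cell-trivial if, for all `F` and all nonzero `G`, there are `H`, `K` such that `F` is a
direct summand of `H ⊠ G ⊠ K`. (The notion is used for idempotent complete `S` only, where a direct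
summand is the same as a retract.) -/
def IsJCellTrivial (S : Type u₁) [Category.{v₁} S] [SemigroupCategory S] : Prop :=
  ∀ F G : S, ¬ Limits.IsZero G → ∃ H K : S, Nonempty (Retract F (H ⊠ (G ⊠ K)))

/-! ## Module categories -/

/-- A (left, semigroup) module category `M` over a semigroup category `S`: a bifunctor
`(F, X) ↦ F ⋆ X` and isomorphisms `(G ⊠ F) ⋆ X ≅ G ⋆ (F ⋆ X)`, natural in all three variables and
satisfying the multiplicative coherence axiom. -/
class ModuleCategory (S : Type u₁) [Category.{v₁} S] [SemigroupCategory S]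
    (M : Type u) [Category.{v} M] where
  actObj : S → M → M
  actLeft (F : S) {X Y : M} (f : X ⟶ Y) : actObj F X ⟶ actObj F Y
  actRight {F G : S} (f : F ⟶ G) (X : M) : actObj F X ⟶ actObj G X
  mult (G F : S) (X : M) : actObj (G ⊠ F) X ≅ actObj G (actObj F X)
  actLeft_id (F : S) (X : M) : actLeft F (𝟙 X) = 𝟙 (actObj F X)
  actLeft_comp (F : S) {X Y Z : M} (f : X ⟶ Y) (g : Y ⟶ Z) :
    actLeft F (f ≫ g) = actLeft F f ≫ actLeft F g
  actRight_id (F : S) (X : M) : actRight (𝟙 F) X = 𝟙 (actObj F X)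
  actRight_comp {F G H : S} (f : F ⟶ G) (g : G ⟶ H) (X : M) :
    actRight (f ≫ g) X = actRight f X ≫ actRight g X
  act_exchange {F G : S} {X Y : M} (f : F ⟶ G) (x : X ⟶ Y) :
    actLeft F x ≫ actRight f Y = actRight f X ≫ actLeft G x
  mult_naturality_left {G G' : S} (g : G ⟶ G') (F : S) (X : M) :
    actRight (g ▷ₛ F) X ≫ (mult G' F X).hom = (mult G F X).hom ≫ actRight g (actObj F X)
  mult_naturality_middle (G : S) {F F' : S} (f : F ⟶ F') (X : M) :
    actRight (G ◁ₛ f) X ≫ (mult G F' X).hom = (mult G F X).hom ≫ actLeft G (actRight f X)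
  mult_naturality_right (G F : S) {X Y : M} (x : X ⟶ Y) :
    actLeft (G ⊠ F) x ≫ (mult G F Y).hom = (mult G F X).hom ≫ actLeft G (actLeft F x)
  mult_pentagon (H G F : S) (X : M) :
    actRight (assoc H G F).hom X ≫ (mult H (G ⊠ F) X).hom ≫ actLeft H (mult G F X).hom =
      (mult (H ⊠ G) F X).hom ≫ (mult H G (actObj F X)).hom

infixr:73 " ⋆ " => ModuleCategory.actObj

open ModuleCategory

/-- The action of `S` on `M` is `k`-bilinear on morphisms. -/
class ModuleCategory.IsLinear (k : Type w) [Field k] (S : Type u₁) [Category.{v₁} S]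
    [Preadditive S] [Linear k S] [SemigroupCategory S] (M : Type u) [Category.{v} M]
    [Preadditive M] [Linear k M] [ModuleCategory S M] : Prop where
  actLeft_add (F : S) {X Y : M} (x y : X ⟶ Y) : actLeft F (x + y) = actLeft F x + actLeft F y
  actLeft_smul (F : S) {X Y : M} (r : k) (x : X ⟶ Y) : actLeft F (r • x) = r • actLeft F x
  actRight_add {F G : S} (f g : F ⟶ G) (X : M) : actRight (f + g) X = actRight f X + actRight g X
  actRight_smul {F G : S} (r : k) (f : F ⟶ G) (X : M) : actRight (r • f) X = r • actRight f X

/-- An `S`-stable ideal of `M`: a two-sided ideal of the `k`-linear category `M`, closed under the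
action of the objects of `S`. -/
structure StableIdeal (k : Type w) [Field k] (S : Type u₁) [Category.{v₁} S]
    [SemigroupCategory S] (M : Type u) [Category.{v} M]
    [Preadditive M] [Linear k M] [ModuleCategory S M] where
  hom (X Y : M) : Submodule k (X ⟶ Y)
  comp_mem {X Y Z : M} (f : X ⟶ Y) {g : Y ⟶ Z} : g ∈ hom Y Z → f ≫ g ∈ hom X Z
  mem_comp {X Y Z : M} {f : X ⟶ Y} (g : Y ⟶ Z) : f ∈ hom X Y → f ≫ g ∈ hom X Z
  act_mem (F : S) {X Y : M} {f : X ⟶ Y} : f ∈ hom X Y → actLeft F f ∈ hom (F ⋆ X) (F ⋆ Y)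

/-- `M` is simple transitive if it has no `S`-stable ideals except `0` and `M`. -/
def IsSimpleTransitive (k : Type w) [Field k] (S : Type u₁) [Category.{v₁} S]
    [SemigroupCategory S] (M : Type u) [Category.{v} M]
    [Preadditive M] [Linear k M] [ModuleCategory S M] : Prop :=
  ∀ I : StableIdeal k S M, (∀ X Y, I.hom X Y = ⊥) ∨ (∀ X Y, I.hom X Y = ⊤)


/-! ## Finite-dimensional presheaves -/

section Presheaf

variable (k : Type w) [Field k] (M : Type u) [Category.{v} M] [Preadditive M] [Linear k M]

/-- A presheaf of finite-dimensional vector spaces is `k`-linear. -/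
def IsLinearPresheaf : ObjectProperty (Mᵒᵖ ⥤ FGModuleCat.{v} k) := fun Φ =>
  Φ.Additive ∧ ∀ (r : k) {X Y : M} (f : X ⟶ Y), Φ.map (r • f).op = r • Φ.map f.op

/-- The category `[Mᵒᵖ, vec]` of `k`-linear functors from `Mᵒᵖ` to finite-dimensional vector
spaces. -/
abbrev FinPresheaf := (IsLinearPresheaf k M).FullSubcategory

variable {k M}

/-- The value of a presheaf at an object. -/
abbrev FinPresheaf.val (Φ : FinPresheaf k M) (X : M) : FGModuleCat.{v} k := Φ.obj.obj (Opposite.op X)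

/-- The action of a morphism on the values of a presheaf. -/
def FinPresheaf.pull (Φ : FinPresheaf k M) {X Y : M} (f : X ⟶ Y) : Φ.val Y →ₗ[k] Φ.val X :=
  (Φ.obj.map f.op).hom.hom

lemma FinPresheaf.pull_id (Φ : FinPresheaf k M) (X : M) (x : Φ.val X) : Φ.pull (𝟙 X) x = x := by
  simp [pull]

lemma FinPresheaf.pull_comp (Φ : FinPresheaf k M) {X Y Z : M} (f : X ⟶ Y) (g : Y ⟶ Z)
    (z : Φ.val Z) : Φ.pull (f ≫ g) z = Φ.pull f (Φ.pull g z) := by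
  simp [pull]

lemma FinPresheaf.pull_add (Φ : FinPresheaf k M) {X Y : M} (f g : X ⟶ Y) (y : Φ.val Y) :
    Φ.pull (f + g) y = Φ.pull f y + Φ.pull g y := by
  have := Φ.property.1
  have h : Φ.obj.map (f + g).op = Φ.obj.map f.op + Φ.obj.map g.op := by
    rw [op_add, Functor.map_add]
  simp only [pull, h]
  rfl

lemma FinPresheaf.pull_smul (Φ : FinPresheaf k M) {X Y : M} (r : k) (f : X ⟶ Y) (y : Φ.val Y) :
    Φ.pull (r • f) y = r • Φ.pull f y := by
  have := Φ.property.2 r f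
  simp only [pull, this]
  rfl

/-- The components of a morphism of presheaves. -/
def FinPresheaf.app {Φ Ψ : FinPresheaf k M} (β : Φ ⟶ Ψ) (X : M) : Φ.val X →ₗ[k] Ψ.val X :=
  (β.hom.app (Opposite.op X)).hom.hom

lemma FinPresheaf.app_pull {Φ Ψ : FinPresheaf k M} (β : Φ ⟶ Ψ) {X Y : M} (f : X ⟶ Y)
    (y : Φ.val Y) : app β X (Φ.pull f y) = Ψ.pull f (app β Y y) :=
  LinearMap.congr_fun (congrArg (fun h => h.hom.hom) (β.hom.naturality f.op)) y

lemma FinPresheaf.hom_ext {Φ Ψ : FinPresheaf k M} {β γ : Φ ⟶ Ψ}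
    (h : ∀ X x, app β X x = app γ X x) : β = γ := by
  ext X x
  exact h X.unop x

/-- A morphism of presheaves from its components. -/
def FinPresheaf.mkHom {Φ Ψ : FinPresheaf k M} (β : ∀ X, Φ.val X →ₗ[k] Ψ.val X)
    (hβ : ∀ {X Y : M} (f : X ⟶ Y) (y : Φ.val Y), β X (Φ.pull f y) = Ψ.pull f (β Y y)) :
    Φ ⟶ Ψ :=
  ObjectProperty.homMk
    { app := fun X => ObjectProperty.homMk (ModuleCat.ofHom (β X.unop))
      naturality := fun X Y f => by
        ext y
        exact hβ f.unop y }

@[simp] lemma FinPresheaf.app_mkHom {Φ Ψ : FinPresheaf k M} (β : ∀ X, Φ.val X →ₗ[k] Ψ.val X)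
    (hβ : ∀ {X Y : M} (f : X ⟶ Y) (y : Φ.val Y), β X (Φ.pull f y) = Ψ.pull f (β Y y)) (X : M) :
    app (mkHom β hβ) X = β X := rfl

variable (k)

/-- Restriction `Φ ↦ Φ ∘ Tᵒᵖ` along a `k`-linear endofunctor `T` of `M`. -/
def restriction (T : M ⥤ M) [T.Additive] [T.Linear k] : FinPresheaf k M ⥤ FinPresheaf k M :=
  ObjectProperty.lift _ ((IsLinearPresheaf k M).ι ⋙ (Functor.whiskeringLeft _ _ _).obj T.op) (by
    intro Φ
    have := Φ.property.1
    refine ⟨⟨fun {X Y f g} => ?_⟩, fun r X Y f => ?_⟩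
    · simp [Functor.map_add]
    · simpa using Φ.property.2 r (T.map f))

variable {k}


/-- A natural transformation between endofunctors induces one between restrictions. -/
def restrictionMap {T T' : M ⥤ M} [T.Additive] [T.Linear k] [T'.Additive] [T'.Linear k]
    (τ : T ⟶ T') : restriction k T' ⟶ restriction k T where
  app Φ := ObjectProperty.homMk (Functor.whiskerRight (NatTrans.op τ) Φ.obj)
  naturality Φ Ψ f := by
    ext X : 3
    exact (f.hom.naturality _).symm

/-- A natural isomorphism between endofunctors induces one between restrictions. -/
def restrictionIso {T T' : M ⥤ M} [T.Additive] [T.Linear k] [T'.Additive] [T'.Linear k]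
    (τ : T ≅ T') : restriction k T' ≅ restriction k T where
  hom := restrictionMap τ.hom
  inv := restrictionMap τ.inv
  hom_inv_id := by
    refine NatTrans.ext (funext fun Φ => FinPresheaf.hom_ext fun X x => ?_)
    refine (Φ.pull_comp (τ.inv.app X) (τ.hom.app X) x).symm.trans ?_
    rw [τ.inv_hom_id_app]
    exact Φ.pull_id _ x
  inv_hom_id := by
    refine NatTrans.ext (funext fun Φ => FinPresheaf.hom_ext fun X x => ?_)
    refine (Φ.pull_comp (τ.hom.app X) (τ.inv.app X) x).symm.trans ?_
    rw [τ.hom_inv_id_app]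
    exact Φ.pull_id _ x

end Presheaf

/-! ### The left adjoint of restriction

If `M` is finitary, restriction along `T` has a left adjoint. It is constructed as the coend
`Y ↦ Hom(Y, T g) ⊗_{End g} Φ(g)`, where `g` is an additive generator of `M`. -/

section Generator

open scoped ModuleCat

/-- A finitary category has finite-dimensional morphism spaces and an object `g` such that every
object is a retract of a finite power of `g`. -/
theorem IsFinitary.exists_generator (k : Type w) [Field k] (M : Type u) [Category.{v} M]
    [Preadditive M] [Linear k M] [IsFinitary k M] :
    ∃ g : M, (∀ X Y : M, Module.Finite k (X ⟶ Y)) ∧ ∀ X : M, ∃ (n : ℕ) (a : Fin n → (X ⟶ g))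
      (b : Fin n → (g ⟶ X)), ∑ i, a i ≫ b i = 𝟙 X := by
  obtain ⟨A, _, _, _, e, he, he'⟩ := IsFinitary.exists_equivalence (k := k) (C := M)
  let G : FinProj A := ⟨ModuleCat.of A A, inferInstance, inferInstance⟩
  refine ⟨e.inverse.obj G, fun X Y => ?_, fun X => ?_⟩
  · obtain ⟨hP, -⟩ := (e.functor.obj X).property
    obtain ⟨hQ, -⟩ := (e.functor.obj Y).property
    have := ModuleCat.isScalarTower_of_algebra_moduleCat (k := k) (e.functor.obj X).obj
    have := ModuleCat.isScalarTower_of_algebra_moduleCat (k := k) (e.functor.obj Y).obj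
    have := Module.Finite.trans (R := k) A (e.functor.obj X).obj
    have := Module.Finite.trans (R := k) A (e.functor.obj Y).obj
    let φ : (X ⟶ Y) →ₗ[k] ((e.functor.obj X).obj →ₗ[k] (e.functor.obj Y).obj) :=
      { toFun := fun f => (e.functor.map f).hom.hom.restrictScalars k
        map_add' := fun f g => by
          rw [Functor.map_add]; rfl
        map_smul' := fun r f => by
          rw [Functor.map_smul]
          rfl }
    refine Module.Finite.of_injective φ fun f g h => e.functor.map_injective ?_
    ext x
    exact LinearMap.congr_fun h x
  · obtain ⟨hP, hP'⟩ := (e.functor.obj X).property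
    obtain ⟨n, f, hf⟩ := Module.Finite.exists_fin' A (e.functor.obj X).obj
    obtain ⟨s, hs⟩ := Module.projective_lifting_property f LinearMap.id hf
    let a' : Fin n → (e.functor.obj X ⟶ G) := fun i =>
      ObjectProperty.homMk (ModuleCat.ofHom (LinearMap.proj i ∘ₗ s))
    let b' : Fin n → (G ⟶ e.functor.obj X) := fun i =>
      ObjectProperty.homMk (ModuleCat.ofHom (f ∘ₗ LinearMap.single A (fun _ => A) i))
    have key : ∑ i, a' i ≫ b' i = 𝟙 (e.functor.obj X) := by
      apply (ObjectProperty.ι _).map_injective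
      rw [Functor.map_sum]
      ext x
      rw [ModuleCat.hom_sum, LinearMap.sum_apply]
      have h2 : ∀ i, ((ObjectProperty.ι _).map (a' i ≫ b' i)).hom x = f (Pi.single i (s x i)) :=
        fun i => rfl
      simp only [h2]
      rw [← map_sum, Finset.univ_sum_single]
      exact LinearMap.congr_fun hs x
    refine ⟨n, fun i => e.unitIso.hom.app X ≫ e.inverse.map (a' i),
      fun i => e.inverse.map (b' i) ≫ e.unitIso.inv.app X, ?_⟩
    have : ∀ i, (e.unitIso.hom.app X ≫ e.inverse.map (a' i)) ≫ e.inverse.map (b' i) ≫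
        e.unitIso.inv.app X = e.unitIso.hom.app X ≫ e.inverse.map (a' i ≫ b' i) ≫
        e.unitIso.inv.app X := fun i => by simp
    simp only [this]
    rw [← Preadditive.comp_sum, ← Preadditive.sum_comp, ← Functor.map_sum, key]
    simp


end Generator

section Extension

open TensorProduct

variable {k : Type w} [Field k] {M : Type u} [Category.{v} M] [Preadditive M] [Linear k M]

/-- A presheaf from its values and its action on morphisms. -/
def FinPresheaf.mkObj (V : M → Type v) [∀ X, AddCommGroup (V X)] [∀ X, Module k (V X)]
    [∀ X, Module.Finite k (V X)] (p : ∀ {X Y : M}, (X ⟶ Y) →ₗ[k] V Y →ₗ[k] V X)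
    (p_id : ∀ X x, p (𝟙 X) x = x)
    (p_comp : ∀ {X Y Z : M} (f : X ⟶ Y) (g : Y ⟶ Z) z, p (f ≫ g) z = p f (p g z)) :
    FinPresheaf k M where
  obj :=
    { obj := fun X => FGModuleCat.of k (V X.unop)
      map := fun f => FGModuleCat.ofHom (p f.unop)
      map_id := fun X => by
        ext x
        exact p_id _ x
      map_comp := fun f g => by
        ext x
        exact p_comp _ _ x }
  property := by
    refine ⟨⟨fun {X Y f g} => ?_⟩, fun r X Y f => ?_⟩
    · ext x
      exact LinearMap.congr_fun (p.map_add f.unop g.unop) x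
    · ext x
      exact LinearMap.congr_fun (p.map_smul r f) x

variable (T : M ⥤ M) (g : M) (Φ : FinPresheaf k M)

/-- The relations that balance the tensor product over `End g`. -/
def extRel (Y : M) : Submodule k ((Y ⟶ T.obj g) ⊗[k] Φ.val g) :=
  Submodule.span k {t | ∃ (y : Y ⟶ T.obj g) (e : g ⟶ g) (x : Φ.val g),
    t = (y ≫ T.map e) ⊗ₜ[k] x - y ⊗ₜ[k] Φ.pull e x}

/-- `Hom(Y, T g) ⊗_{End g} Φ(g)`. -/
abbrev ExtVal (Y : M) : Type v := ((Y ⟶ T.obj g) ⊗[k] Φ.val g) ⧸ extRel T g Φ Y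

/-- The class of a pure tensor. -/
def extMk {Y : M} (y : Y ⟶ T.obj g) (x : Φ.val g) : ExtVal T g Φ Y :=
  (extRel T g Φ Y).mkQ (y ⊗ₜ x)

lemma extMk_rel {Y : M} (y : Y ⟶ T.obj g) (e : g ⟶ g) (x : Φ.val g) :
    extMk T g Φ (y ≫ T.map e) x = extMk T g Φ y (Φ.pull e x) := by
  simp only [extMk]
  rw [← sub_eq_zero, ← map_sub]
  exact (Submodule.Quotient.mk_eq_zero _).2 (Submodule.subset_span ⟨y, e, x, rfl⟩)

/-- The class of a pure tensor, as a bilinear map. -/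
def extMkₗ (Y : M) : (Y ⟶ T.obj g) →ₗ[k] Φ.val g →ₗ[k] ExtVal T g Φ Y :=
  (TensorProduct.mk k _ _).compr₂ (extRel T g Φ Y).mkQ

lemma extMkₗ_apply {Y : M} (y : Y ⟶ T.obj g) (x : Φ.val g) :
    extMkₗ T g Φ Y y x = extMk T g Φ y x := rfl

/-- The universal property of the balanced tensor product. -/
def extLift {Y : M} {W : Type*} [AddCommGroup W] [Module k W]
    (B : (Y ⟶ T.obj g) →ₗ[k] Φ.val g →ₗ[k] W)
    (hB : ∀ y (e : g ⟶ g) x, B (y ≫ T.map e) x = B y (Φ.pull e x)) : ExtVal T g Φ Y →ₗ[k] W :=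
  (extRel T g Φ Y).liftQ (TensorProduct.lift B) (Submodule.span_le.2 (by
    rintro _ ⟨y, e, x, rfl⟩
    simp [hB]))

lemma extLift_mk {Y : M} {W : Type*} [AddCommGroup W] [Module k W]
    (B : (Y ⟶ T.obj g) →ₗ[k] Φ.val g →ₗ[k] W)
    (hB : ∀ y (e : g ⟶ g) x, B (y ≫ T.map e) x = B y (Φ.pull e x)) (y : Y ⟶ T.obj g)
    (x : Φ.val g) : extLift T g Φ B hB (extMk T g Φ y x) = B y x := by
  exact (Submodule.liftQ_apply _ _ _).trans (TensorProduct.lift.tmul _ _)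

lemma ext_induction {Y : M} {W : Type*} [AddCommGroup W] [Module k W]
    {f f' : ExtVal T g Φ Y →ₗ[k] W}
    (h : ∀ y x, f (extMk T g Φ y x) = f' (extMk T g Φ y x)) : f = f' := by
  apply Submodule.linearMap_qext
  apply TensorProduct.ext'
  exact h

/-- The action of morphisms on the balanced tensor products. -/
def extPull (X Y : M) : (X ⟶ Y) →ₗ[k] ExtVal T g Φ Y →ₗ[k] ExtVal T g Φ X where
  toFun f := extLift T g Φ ((extMkₗ T g Φ X).comp (Linear.leftComp k _ f))
    (fun y e x => by
      simp only [LinearMap.comp_apply, Linear.leftComp_apply, extMkₗ_apply]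
      rw [← Category.assoc, extMk_rel])
  map_add' f f' := ext_induction T g Φ fun y x => by
    simp [extLift_mk, LinearMap.add_apply]
  map_smul' r f := ext_induction T g Φ fun y x => by
    simp [extLift_mk, LinearMap.smul_apply]

lemma extPull_mk {X Y : M} (f : X ⟶ Y) (y : Y ⟶ T.obj g) (x : Φ.val g) :
    extPull T g Φ X Y f (extMk T g Φ y x) = extMk T g Φ (f ≫ y) x := by
  simp only [extPull, LinearMap.coe_mk, AddHom.coe_mk, extLift_mk]
  rfl

/-- The presheaf `Y ↦ Hom(Y, T g) ⊗_{End g} Φ(g)`. -/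
def extObj [∀ X Y : M, Module.Finite k (X ⟶ Y)] : FinPresheaf k M :=
  FinPresheaf.mkObj (ExtVal T g Φ) (fun {X Y} => extPull T g Φ X Y)
    (fun X => LinearMap.congr_fun (g := LinearMap.id) (ext_induction T g Φ fun y x => by
      simp [extPull_mk]))
    (fun {X Y Z} f f' => LinearMap.congr_fun
      (g := (extPull T g Φ X Y f).comp (extPull T g Φ Y Z f')) (ext_induction T g Φ fun y x => by
        simp [extPull_mk]))

variable [∀ X Y : M, Module.Finite k (X ⟶ Y)]

/-- The values of `extObj`. -/
def ofExt (Y : M) : ExtVal T g Φ Y ≃ₗ[k] (extObj T g Φ).val Y := LinearEquiv.refl k _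

lemma extObj_pull {X Y : M} (f : X ⟶ Y) (y : Y ⟶ T.obj g) (x : Φ.val g) :
    (extObj T g Φ).pull f (ofExt T g Φ Y (extMk T g Φ y x)) =
      ofExt T g Φ X (extMk T g Φ (f ≫ y) x) :=
  extPull_mk T g Φ f y x

variable {g Φ} in
lemma extObj_ind {Y : M} {W : Type*} [AddCommGroup W] [Module k W]
    {f f' : (extObj T g Φ).val Y →ₗ[k] W}
    (h : ∀ y x, f (ofExt T g Φ Y (extMk T g Φ y x)) = f' (ofExt T g Φ Y (extMk T g Φ y x)))
    (z : (extObj T g Φ).val Y) : f z = f' z :=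
  LinearMap.congr_fun (ext_induction T g Φ (f := f) (f' := f') h) z

variable [T.Additive] [T.Linear k]

variable {Φ} in
/-- The components of a morphism into a restriction. -/
def FinPresheaf.appR {Ψ : FinPresheaf k M} (α : Φ ⟶ (restriction k T).obj Ψ) (X : M) :
    Φ.val X →ₗ[k] Ψ.val (T.obj X) := FinPresheaf.app α X

variable {Φ} in
lemma FinPresheaf.appR_pull {Ψ : FinPresheaf k M} (α : Φ ⟶ (restriction k T).obj Ψ) {X Y : M}
    (f : X ⟶ Y) (y : Φ.val Y) : appR T α X (Φ.pull f y) = Ψ.pull (T.map f) (appR T α Y y) :=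
  FinPresheaf.app_pull α f y

variable {Φ} in
/-- A morphism into a restriction from its components. -/
def FinPresheaf.mkHomR {Ψ : FinPresheaf k M} (β : ∀ X, Φ.val X →ₗ[k] Ψ.val (T.obj X))
    (hβ : ∀ {X Y : M} (f : X ⟶ Y) (y : Φ.val Y),
      β X (Φ.pull f y) = Ψ.pull (T.map f) (β Y y)) : Φ ⟶ (restriction k T).obj Ψ :=
  FinPresheaf.mkHom β hβ

theorem restriction_isRightAdjoint_aux
    (hg : ∀ X : M, ∃ (n : ℕ) (a : Fin n → (X ⟶ g)) (b : Fin n → (g ⟶ X)),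
      ∑ i, a i ≫ b i = 𝟙 X) : (restriction k T).IsRightAdjoint := by
  choose n a b hab using hg
  have pull_sum (Φ : FinPresheaf k M) (X : M) (x : Φ.val X) :
      ∑ i, Φ.pull (a X i) (Φ.pull (b X i) x) = x := by
    have h : ∀ (ι : Finset (Fin (n X))), Φ.pull (∑ i ∈ ι, a X i ≫ b X i) x =
        ∑ i ∈ ι, Φ.pull (a X i) (Φ.pull (b X i) x) := by
      intro ι
      induction ι using Finset.induction_on with
      | empty =>
        have := Φ.pull_smul (0 : k) (𝟙 X) x
        simpa using this
      | insert i ι hi ih => rw [Finset.sum_insert hi, Finset.sum_insert hi, Φ.pull_add, ih,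
          Φ.pull_comp]
    rw [← h, hab, Φ.pull_id]
  let U (Φ : FinPresheaf k M) (X : M) : Φ.val X →ₗ[k] ExtVal T g Φ (T.obj X) :=
    ∑ i, (extMkₗ T g Φ (T.obj X) (T.map (a X i))).comp (Φ.pull (b X i))
  have U_apply (Φ : FinPresheaf k M) (X : M) (x : Φ.val X) : U Φ X x =
      ∑ i, extMk T g Φ (T.map (a X i)) (Φ.pull (b X i) x) := by
    simp [U, LinearMap.sum_apply, extMkₗ_apply]
  have U_pull (Φ : FinPresheaf k M) (X : M) (e : X ⟶ g) (x : Φ.val g) :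
      U Φ X (Φ.pull e x) = extMk T g Φ (T.map e) x := by
    rw [U_apply]
    have h : ∀ i, extMk T g Φ (T.map (a X i)) (Φ.pull (b X i) (Φ.pull e x)) =
        (extMkₗ T g Φ (T.obj X)).flip x (T.map ((a X i ≫ b X i) ≫ e)) := by
      intro i
      rw [← Φ.pull_comp, ← extMk_rel, LinearMap.flip_apply, extMkₗ_apply]
      simp
    simp only [h]
    rw [← map_sum, ← Functor.map_sum, ← Preadditive.sum_comp, hab, Category.id_comp]
    rfl
  let unit (Φ : FinPresheaf k M) : Φ ⟶ (restriction k T).obj (extObj T g Φ) :=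
    FinPresheaf.mkHomR T (fun X => (ofExt T g Φ (T.obj X)).toLinearMap ∘ₗ U Φ X) (by
      intro X Y f y
      simp only [LinearMap.comp_apply, LinearEquiv.coe_coe]
      conv_lhs => rw [← pull_sum Φ Y y]
      rw [map_sum, map_sum, map_sum, U_apply, map_sum, map_sum]
      refine Finset.sum_congr rfl fun j _ => ?_
      rw [← Φ.pull_comp, U_pull, extObj_pull, Functor.map_comp])
  let C (Φ Ψ : FinPresheaf k M) (α : Φ ⟶ (restriction k T).obj Ψ) (Y : M) :
      (extObj T g Φ).val Y →ₗ[k] Ψ.val Y :=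
    (extLift T g Φ
      (LinearMap.mk₂ k (fun (y : Y ⟶ T.obj g) x => Ψ.pull y (FinPresheaf.appR T α g x))
        (fun y y' x => Ψ.pull_add y y' _) (fun r y x => Ψ.pull_smul r y _)
        (fun y x x' => by rw [map_add, map_add]) (fun r y x => by rw [map_smul, map_smul]))
      (fun y e x => by
        simp only [LinearMap.mk₂_apply]
        rw [Ψ.pull_comp, FinPresheaf.appR_pull])) ∘ₗ (ofExt T g Φ Y).symm.toLinearMap
  have C_mk (Φ Ψ : FinPresheaf k M) (α : Φ ⟶ (restriction k T).obj Ψ) (Y : M)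
      (y : Y ⟶ T.obj g) (x : Φ.val g) :
      C Φ Ψ α Y (ofExt T g Φ Y (extMk T g Φ y x)) = Ψ.pull y (FinPresheaf.appR T α g x) := by
    simp only [C, LinearMap.comp_apply, LinearEquiv.coe_coe,
      LinearEquiv.symm_apply_apply, extLift_mk, LinearMap.mk₂_apply]
  let inv (Φ Ψ : FinPresheaf k M) (α : Φ ⟶ (restriction k T).obj Ψ) : extObj T g Φ ⟶ Ψ :=
    FinPresheaf.mkHom (C Φ Ψ α) (fun {X Y} f => extObj_ind T
      (f := C Φ Ψ α X ∘ₗ (extObj T g Φ).pull f) (f' := Ψ.pull f ∘ₗ C Φ Ψ α Y) fun y x => by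
        simp only [LinearMap.comp_apply, extObj_pull, C_mk, Ψ.pull_comp])
  have toFun_apply (Φ Ψ : FinPresheaf k M) (β : extObj T g Φ ⟶ Ψ) (X : M) (x : Φ.val X) :
      FinPresheaf.appR T (unit Φ ≫ (restriction k T).map β) X x =
        FinPresheaf.app β (T.obj X) (ofExt T g Φ (T.obj X) (U Φ X x)) := rfl
  let e (Φ Ψ : FinPresheaf k M) : (extObj T g Φ ⟶ Ψ) ≃ (Φ ⟶ (restriction k T).obj Ψ) :=
    { toFun := fun β => unit Φ ≫ (restriction k T).map β
      invFun := inv Φ Ψ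
      left_inv := fun β => by
        apply FinPresheaf.hom_ext
        intro Y
        refine extObj_ind T fun y x => ?_
        change C Φ Ψ _ Y _ = _
        rw [C_mk, toFun_apply, ← FinPresheaf.app_pull]
        have h := U_pull Φ g (𝟙 g) x
        rw [Φ.pull_id] at h
        rw [h, extObj_pull, T.map_id, Category.comp_id]
      right_inv := fun α => by
        apply FinPresheaf.hom_ext
        intro X x
        change FinPresheaf.appR T (unit Φ ≫ (restriction k T).map (inv Φ Ψ α)) X x =
          FinPresheaf.appR T α X x
        rw [toFun_apply, U_apply, map_sum, map_sum]
        have h : ∀ i, FinPresheaf.app (inv Φ Ψ α) (T.obj X)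
            (ofExt T g Φ (T.obj X) (extMk T g Φ (T.map (a X i)) (Φ.pull (b X i) x))) =
            FinPresheaf.appR T α X (Φ.pull (a X i) (Φ.pull (b X i) x)) := fun i => by
          rw [FinPresheaf.appR_pull]
          exact C_mk _ _ _ _ _ _
        simp only [h]
        rw [← map_sum, pull_sum] }
  exact (Adjunction.adjunctionOfEquivLeft e (by
    intro Φ Ψ Ψ' β γ
    simp [e])).isRightAdjoint


instance restriction_isRightAdjoint (T : M ⥤ M) [T.Additive] [T.Linear k] [IsFinitary k M] :
    (restriction k T).IsRightAdjoint := by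
  obtain ⟨g, hfin, hg⟩ := IsFinitary.exists_generator k M
  exact restriction_isRightAdjoint_aux T g hg

end Extension

/-! ## The extended action -/

section Action

variable (k : Type w) [Field k] {S : Type u₁} [Category.{v₁} S] [Preadditive S] [Linear k S]
  [SemigroupCategory S] (M : Type u) [Category.{v} M] [Preadditive M] [Linear k M]
  [ModuleCategory S M]

/-- The endofunctor `F ⋆ -` of `M`. -/
def actFunctor (F : S) : M ⥤ M where
  obj X := F ⋆ X
  map f := actLeft F f
  map_id X := actLeft_id F X
  map_comp f g := actLeft_comp F f g

variable [hlin : ModuleCategory.IsLinear k S M]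

lemma actFunctor_additive (F : S) : (actFunctor M F).Additive ∧ (actFunctor M F).Linear k :=
  ⟨⟨ModuleCategory.IsLinear.actLeft_add k F _ _⟩,
    ⟨fun f r => ModuleCategory.IsLinear.actLeft_smul F r f⟩⟩

/-- Restriction along `F ⋆ -`. -/
def actRestriction (F : S) : FinPresheaf k M ⥤ FinPresheaf k M :=
  haveI := (actFunctor_additive k M F).1
  haveI := (actFunctor_additive k M F).2
  restriction k (actFunctor M F)

variable {M}

/-- The natural transformation `F ⋆ - ⟶ G ⋆ -` induced by a morphism of `S`. -/
def actTrans {F G : S} (f : F ⟶ G) : actFunctor M F ⟶ actFunctor M G where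
  app X := actRight f X
  naturality _ _ x := act_exchange f x

/-- The natural isomorphism `(G ⊠ F) ⋆ - ≅ G ⋆ (F ⋆ -)`. -/
def actMultIso (G F : S) : actFunctor M (G ⊠ F) ≅ actFunctor M F ⋙ actFunctor M G :=
  NatIso.ofComponents (fun X => mult G F X) (fun x => mult_naturality_right G F x)

variable (M)

/-- The transformation of restriction functors induced by a morphism of `S`. -/
def actRestrictionMap {F G : S} (f : F ⟶ G) : actRestriction k M G ⟶ actRestriction k M F :=
  haveI := (actFunctor_additive k M F).1
  haveI := (actFunctor_additive k M F).2
  haveI := (actFunctor_additive k M G).1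
  haveI := (actFunctor_additive k M G).2
  restrictionMap (actTrans f)

/-- Restriction along `(G ⊠ F) ⋆ -` is restriction along `G ⋆ -` followed by restriction along
`F ⋆ -`. -/
def actRestrictionMult (G F : S) :
    actRestriction k M G ⋙ actRestriction k M F ≅ actRestriction k M (G ⊠ F) :=
  haveI := (actFunctor_additive k M F).1
  haveI := (actFunctor_additive k M F).2
  haveI := (actFunctor_additive k M G).1
  haveI := (actFunctor_additive k M G).2
  haveI := (actFunctor_additive k M (G ⊠ F)).1
  haveI := (actFunctor_additive k M (G ⊠ F)).2
  restrictionIso (actMultIso G F)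

variable [IsFinitary k M]

/-- The extension of `F ⋆ -` to presheaves, `(F ⋆ -)_!`: the left adjoint of restriction along
`F ⋆ -`. -/
noncomputable def actExtension (F : S) : FinPresheaf k M ⥤ FinPresheaf k M :=
  haveI := (actFunctor_additive k M F).1
  haveI := (actFunctor_additive k M F).2
  (restriction k (actFunctor M F)).leftAdjoint

/-- The defining adjunction of `(F ⋆ -)_!`. -/
noncomputable def actExtensionAdj (F : S) : actExtension k M F ⊣ actRestriction k M F :=
  haveI := (actFunctor_additive k M F).1
  haveI := (actFunctor_additive k M F).2
  Adjunction.ofIsRightAdjoint (restriction k (actFunctor M F))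

/-- The transformation `(F ⋆ -)_! ⟶ (G ⋆ -)_!` induced by a morphism of `S`. -/
noncomputable def actExtensionMap {F G : S} (f : F ⟶ G) :
    actExtension k M F ⟶ actExtension k M G :=
  (conjugateEquiv (actExtensionAdj k M G) (actExtensionAdj k M F)).symm (actRestrictionMap k M f)

/-- The isomorphism `((G ⊠ F) ⋆ -)_! ≅ (G ⋆ -)_! ∘ (F ⋆ -)_!`. -/
noncomputable def actExtensionMult (G F : S) :
    actExtension k M (G ⊠ F) ≅ actExtension k M F ⋙ actExtension k M G :=
  (conjugateIsoEquiv ((actExtensionAdj k M F).comp (actExtensionAdj k M G))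
    (actExtensionAdj k M (G ⊠ F))).symm (actRestrictionMult k M G F)

/-- The components of `actExtensionMult`. -/
noncomputable def actExtensionMultApp (G F : S) (Φ : FinPresheaf k M) :
    (actExtension k M (G ⊠ F)).obj Φ ≅ (actExtension k M G).obj ((actExtension k M F).obj Φ) :=
  (actExtensionMult k M G F).app Φ

variable {M}

/-- The unit of the adjunction, on elements. -/
noncomputable def actUnit (F : S) (Φ : FinPresheaf k M) (X : M) :
    Φ.val X →ₗ[k] ((actExtension k M F).obj Φ).val (F ⋆ X) :=
  FinPresheaf.app ((actExtensionAdj k M F).unit.app Φ) X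

variable {k}

lemma actUnit_pull (F : S) (Φ : FinPresheaf k M) {X Y : M} (x : X ⟶ Y) (y : Φ.val Y) :
    actUnit k F Φ X (Φ.pull x y) =
      ((actExtension k M F).obj Φ).pull (actLeft F x) (actUnit k F Φ Y y) :=
  FinPresheaf.app_pull ((actExtensionAdj k M F).unit.app Φ) x y

lemma app_actExtension_map (F : S) {Φ Ψ : FinPresheaf k M} (α : Φ ⟶ Ψ) (X : M) (x : Φ.val X) :
    FinPresheaf.app ((actExtension k M F).map α) (F ⋆ X) (actUnit k F Φ X x) =
      actUnit k F Ψ X (FinPresheaf.app α X x) :=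
  (congrArg (fun β => FinPresheaf.app β X x) ((actExtensionAdj k M F).unit.naturality α)).symm

lemma app_actExtensionMap {F G : S} (f : F ⟶ G) (Φ : FinPresheaf k M) (X : M) (x : Φ.val X) :
    FinPresheaf.app ((actExtensionMap k M f).app Φ) (F ⋆ X) (actUnit k F Φ X x) =
      ((actExtension k M G).obj Φ).pull (actRight f X) (actUnit k G Φ X x) :=
  (congrArg (fun β => FinPresheaf.app β X x) (unit_conjugateEquiv_symm (actExtensionAdj k M G)
    (actExtensionAdj k M F) (actRestrictionMap k M f) Φ)).symm

lemma app_actExtensionMultApp (G F : S) (Φ : FinPresheaf k M) (X : M) (x : Φ.val X) :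
    FinPresheaf.app (actExtensionMultApp k M G F Φ).hom ((G ⊠ F) ⋆ X)
      (actUnit k (G ⊠ F) Φ X x) =
      ((actExtension k M G).obj ((actExtension k M F).obj Φ)).pull (mult G F X).hom
        (actUnit k G _ _ (actUnit k F Φ X x)) := by
  have h := unit_conjugateEquiv_symm ((actExtensionAdj k M F).comp (actExtensionAdj k M G))
    (actExtensionAdj k M (G ⊠ F)) (actRestrictionMult k M G F).hom Φ
  have h1 := congrArg (fun β => FinPresheaf.app β X x) h
  refine Eq.trans h1.symm ?_
  rw [Adjunction.comp_unit_app]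
  rfl

lemma actExtension_hom_ext {F : S} {Φ Ψ : FinPresheaf k M}
    {β γ : (actExtension k M F).obj Φ ⟶ Ψ}
    (h : ∀ (X : M) (x : Φ.val X), FinPresheaf.app β (F ⋆ X) (actUnit k F Φ X x) =
      FinPresheaf.app γ (F ⋆ X) (actUnit k F Φ X x)) : β = γ := by
  apply ((actExtensionAdj k M F).homEquiv Φ Ψ).injective
  rw [Adjunction.homEquiv_unit, Adjunction.homEquiv_unit]
  exact FinPresheaf.hom_ext h

lemma FinPresheaf.app_comp {Φ Ψ Θ : FinPresheaf k M} (α : Φ ⟶ Ψ) (β : Ψ ⟶ Θ) (X : M)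
    (x : Φ.val X) : app (α ≫ β) X x = app β X (app α X x) := rfl

lemma FinPresheaf.app_id (Φ : FinPresheaf k M) (X : M) (x : Φ.val X) : app (𝟙 Φ) X x = x := rfl

variable (k M) in
/-- The action of `S` on `[Mᵒᵖ, vec]` that extends the action on `M`: `F ⋆ Φ = (F ⋆ -)_! Φ`. -/
noncomputable instance finPresheafModuleCategory : ModuleCategory S (FinPresheaf k M) where
  actObj F Φ := (actExtension k M F).obj Φ
  actLeft F _ _ α := (actExtension k M F).map α
  actRight f Φ := (actExtensionMap k M f).app Φ
  mult G F Φ := actExtensionMultApp k M G F Φ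
  actLeft_id F Φ := (actExtension k M F).map_id Φ
  actLeft_comp F _ _ _ α β := (actExtension k M F).map_comp α β
  actRight_id F Φ := actExtension_hom_ext fun X x => by
    rw [app_actExtensionMap, actRight_id, FinPresheaf.pull_id, FinPresheaf.app_id]
  actRight_comp f g Φ := actExtension_hom_ext fun X x => by
    rw [FinPresheaf.app_comp, app_actExtensionMap, app_actExtensionMap, FinPresheaf.app_pull,
      app_actExtensionMap, actRight_comp, FinPresheaf.pull_comp]
  act_exchange f α := (actExtensionMap k M f).naturality α
  mult_naturality_left g F Φ := actExtension_hom_ext fun X x => by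
    simp only [FinPresheaf.app_comp, app_actExtensionMap, FinPresheaf.app_pull,
      app_actExtensionMultApp, ← FinPresheaf.pull_comp, mult_naturality_left]
  mult_naturality_middle G _ _ f Φ := actExtension_hom_ext fun X x => by
    simp only [FinPresheaf.app_comp, app_actExtensionMap, FinPresheaf.app_pull,
      app_actExtensionMultApp, ← FinPresheaf.pull_comp, mult_naturality_middle, app_actExtension_map,
      actUnit_pull]
  mult_naturality_right G F _ _ α := (actExtensionMult k M G F).hom.naturality α
  mult_pentagon H G F Φ := actExtension_hom_ext fun X x => by
    simp only [FinPresheaf.app_comp, app_actExtensionMap, FinPresheaf.app_pull,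
      app_actExtensionMultApp, ← FinPresheaf.pull_comp, mult_pentagon, app_actExtension_map,
      actUnit_pull]

lemma FinPresheaf.app_add {Φ Ψ : FinPresheaf k M} (α β : Φ ⟶ Ψ) (X : M) (x : Φ.val X) :
    app (α + β) X x = app α X x + app β X x := rfl

lemma FinPresheaf.app_smul {Φ Ψ : FinPresheaf k M} (r : k) (α : Φ ⟶ Ψ) (X : M) (x : Φ.val X) :
    app (r • α) X x = r • app α X x := rfl

lemma actExtension_map_add (F : S) {Φ Ψ : FinPresheaf k M} (α β : Φ ⟶ Ψ) :
    (actExtension k M F).map (α + β) = (actExtension k M F).map α + (actExtension k M F).map β :=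
  actExtension_hom_ext fun X x => by
    simp only [FinPresheaf.app_add, app_actExtension_map, map_add]

lemma actExtension_map_smul (F : S) {Φ Ψ : FinPresheaf k M} (r : k) (α : Φ ⟶ Ψ) :
    (actExtension k M F).map (r • α) = r • (actExtension k M F).map α :=
  actExtension_hom_ext fun X x => by
    simp only [FinPresheaf.app_smul, app_actExtension_map, map_smul]

lemma actExtensionMap_add {F G : S} (f g : F ⟶ G) (Φ : FinPresheaf k M) :
    (actExtensionMap k M (f + g)).app Φ =
      (actExtensionMap k M f).app Φ + (actExtensionMap k M g).app Φ :=
  actExtension_hom_ext fun X x => by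
    simp only [FinPresheaf.app_add, app_actExtensionMap,
      ModuleCategory.IsLinear.actRight_add k, FinPresheaf.pull_add]

lemma actExtensionMap_smul {F G : S} (r : k) (f : F ⟶ G) (Φ : FinPresheaf k M) :
    (actExtensionMap k M (r • f)).app Φ = r • (actExtensionMap k M f).app Φ :=
  actExtension_hom_ext fun X x => by
    simp only [FinPresheaf.app_smul, app_actExtensionMap,
      ModuleCategory.IsLinear.actRight_smul, FinPresheaf.pull_smul]

/-- The extended action is `k`-linear. -/
instance finPresheafIsLinear : ModuleCategory.IsLinear k S (FinPresheaf k M) where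
  actLeft_add F _ _ α β := actExtension_map_add F α β
  actLeft_smul F _ _ r α := actExtension_map_smul F r α
  actRight_add f g Φ := actExtensionMap_add f g Φ
  actRight_smul r f Φ := actExtensionMap_smul r f Φ

end Action

/-- A module category `P` over `S` is projectivizing if it is abelian, has enough projectives, and
`F ⋆ X` is projective for all objects `F` of `S` and `X` of `P`. -/
structure IsProjectivizing (S : Type u₁) [Category.{v₁} S] [SemigroupCategory S] (P : Type u)
    [Category.{v} P] [ModuleCategory S P] : Prop where
  abelian : Nonempty (Abelian P)
  enoughProjectives : EnoughProjectives P
  projective (F : S) (X : P) : Projective (F ⋆ X)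

end SgCat

open SgCat

namespace SgCat

open SemigroupCategory ModuleCategory

/-! ## Linear algebra -/

/-! The heart of the proof is that each `F` in `S` sends every morphism of `M` to a von Neumann
regular one, that is, to some `f` with `f ≫ q ≫ f = f` (`isRegularHom_actLeft`). Granted this,
present a presheaf `Φ` by representables as the cokernel of some `d`. The image of `d` under `F` is
regular, so its cokernel `F ⋆ Φ` splits off the image of a representable. That image is projective,
because the left adjoint of an epimorphism-preserving functor preserves projectives
(`projective_actExtension_obj`).

Regularity comes from a growth argument (`isRegularHom_map_of_growth`). Let `g` and `γ` be additive
generators of `M` and `S`, let `Θ` be a large multiple of `γ`, let `T = Θ ⋆ -`, and let `m n` be the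
dimension of `Hom(g, T ^ n g)`; this is submultiplicative. Simple transitivity makes `T u` split off
`g` for every nonzero `u`. J-cell-triviality makes `γ` a summand of `Θ ⊠ (I ⊠ Θ)` for every nonzero
`I`. Decomposing a tensor power of `Θ` into boundedly large summands `I` therefore puts at least a
fixed positive fraction of `m (n + 1)` copies of `γ ⋆ -` into `T ^ (n + 3)`.

If `γ ⋆ f` were not regular, then whatever has already been split off `T ^ (n + 3) f`, the remainder
would have rank at least proportional to `m (n + 1)` (`exists_le_homRank_of_not_isRegularHom`). One
more application of `T` turns this rank into proportionally many new copies of `g`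
(`exists_splitsOff_of_homRank`). Each generation of copies keeps pace with `m` under further
applications of `T`, so `n` generations occupy at least a constant times `n * m n` dimensions. Only
a constant times `m n` dimensions are available: a contradiction for large `n`. -/

/-- If `s` is closed under scalars, then an element of its span is a sum of as many elements of `s`
as the dimension of the ambient space. -/
lemma exists_sum_of_mem_span {k : Type*} [Field k] {V : Type*} [AddCommGroup V] [Module k V]
    [Module.Finite k V] {s : Set V} (hs : ∀ (r : k), ∀ v ∈ s, r • v ∈ s) (h0 : (0 : V) ∈ s) {x : V}
    (hx : x ∈ Submodule.span k s) {D : ℕ} (hD : Module.finrank k V ≤ D) :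
    ∃ y : Fin D → V, (∀ i, y i ∈ s) ∧ ∑ i, y i = x := by
  classical
  -- A basis of the span chosen inside `s` has at most `D` members. Scaling them stays in `s`, and
  -- the unused indices receive `0`.
  obtain ⟨b, hbs, hspan, hli⟩ := exists_linearIndependent k s
  have : Fintype b := (LinearIndependent.setFinite hli).fintype
  have hcard : Fintype.card b ≤ Fintype.card (Fin D) := by
    rw [Fintype.card_fin]
    exact hli.fintype_card_le_finrank.trans hD
  obtain ⟨f⟩ := Function.Embedding.nonempty_of_card_le hcard
  rw [← hspan] at hx
  have hx' : x ∈ Submodule.span k (Set.range ((↑) : b → V)) := by simpa using hx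
  obtain ⟨c, hc⟩ := (Submodule.mem_span_range_iff_exists_fun k).1 hx'
  refine ⟨Function.extend f (fun v => c v • (v : V)) 0, fun i => ?_, ?_⟩
  · by_cases hi : ∃ v, f v = i
    · obtain ⟨v, rfl⟩ := hi
      rw [f.injective.extend_apply]
      exact hs _ _ (hbs v.2)
    · rw [Function.extend_apply' _ _ _ hi]
      exact h0
  · rw [← hc, ← Finset.sum_subset (Finset.subset_univ (Finset.univ.map f)) fun i _ hi => ?_]
    · simp [f.injective.extend_apply]
    · exact Function.extend_apply' _ _ _ fun ⟨v, hv⟩ => hi (by simp [← hv])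

/-! ## Regular morphisms -/

section Regular

variable {C : Type u} [Category.{v} C]

/-- A morphism is (von Neumann) regular if it has a generalized inverse. -/
def IsRegularHom {X Y : C} (f : X ⟶ Y) : Prop := ∃ q : Y ⟶ X, f ≫ q ≫ f = f

lemma isRegularHom_zero [Preadditive C] (X Y : C) : IsRegularHom (0 : X ⟶ Y) := ⟨0, by simp⟩

/-- A retract of copies of a regular morphism is regular. -/
lemma IsRegularHom.of_sum_retract [Preadditive C] {X Y X' Y' : C} {f : X ⟶ Y} {f' : X' ⟶ Y'}
    (hf : IsRegularHom f) {n : ℕ} (iX : Fin n → (X' ⟶ X)) (rX : Fin n → (X ⟶ X'))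
    (iY : Fin n → (Y' ⟶ Y)) (rY : Fin n → (Y ⟶ Y')) (hi : ∀ l, iX l ≫ f = f' ≫ iY l)
    (hr : ∀ l, f ≫ rY l = rX l ≫ f') (hX : ∑ l, iX l ≫ rX l = 𝟙 X') : IsRegularHom f' := by
  obtain ⟨q, hq⟩ := hf
  -- Compress `q` to each copy and add. The intertwining relations turn the `l`-th term of `f' ≫ _ ≫
  -- f'` into `(iX l ≫ rX l) ≫ f'`, so no orthogonality between different copies is needed.
  refine ⟨∑ l, iY l ≫ q ≫ rX l, ?_⟩
  have h : ∀ l, f' ≫ (iY l ≫ q ≫ rX l) ≫ f' = (iX l ≫ rX l) ≫ f' := by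
    intro l
    have h1 : f' ≫ (iY l ≫ q ≫ rX l) ≫ f' = (f' ≫ iY l) ≫ q ≫ (rX l ≫ f') := by
      simp only [Category.assoc]
    have h2 : (iX l ≫ f) ≫ q ≫ f ≫ rY l = iX l ≫ (f ≫ q ≫ f) ≫ rY l := by
      simp only [Category.assoc]
    rw [h1, ← hi, ← hr, h2, hq, hr, Category.assoc]
  rw [Preadditive.sum_comp, Preadditive.comp_sum, Finset.sum_congr rfl fun l _ => h l,
    ← Preadditive.sum_comp, hX, Category.id_comp]

end Regular

/-! ## Objects that split off a morphism -/

section Splits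

variable {C : Type u} [Category.{v} C] [Preadditive C]

/-- The direct sum of the objects `Z i` splits off the morphism `f`: its identity factors through
`f`. -/
def SplitsOff {X Y : C} (f : X ⟶ Y) {ι : Type*} (Z : ι → C) : Prop :=
  ∃ (a : ∀ i, Z i ⟶ X) (b : ∀ i, Y ⟶ Z i), (∀ i, a i ≫ f ≫ b i = 𝟙 (Z i)) ∧
    ∀ i j, i ≠ j → a i ≫ f ≫ b j = 0

lemma SplitsOff.map {D : Type*} [Category* D] [Preadditive D] {X Y : C} {f : X ⟶ Y} {ι : Type*}
    {Z : ι → C} (h : SplitsOff f Z) (T : C ⥤ D) [T.Additive] :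
    SplitsOff (T.map f) fun i => T.obj (Z i) := by
  obtain ⟨a, b, h1, h2⟩ := h
  refine ⟨fun i => T.map (a i), fun i => T.map (b i), fun i => ?_, fun i j hij => ?_⟩
  · rw [← T.map_comp, ← T.map_comp, h1, T.map_id]
  · rw [← T.map_comp, ← T.map_comp, h2 i j hij, T.map_zero]

lemma SplitsOff.reindex {X Y : C} {f : X ⟶ Y} {ι κ : Type*}
    {Z : ι → C} (h : SplitsOff f Z) {e : κ → ι} (he : Function.Injective e) :
    SplitsOff f fun i => Z (e i) := by
  obtain ⟨a, b, h1, h2⟩ := h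
  exact ⟨fun i => a (e i), fun i => b (e i), fun i => h1 _, fun i j hij => h2 _ _ (he.ne hij)⟩

/-- The part of `f` that remains when a summand is split off. -/
lemma SplitsOff.exists_remainder {X Y : C} {f : X ⟶ Y} {ι : Type*} [Fintype ι] {Z : ι → C}
    {a : ∀ i, Z i ⟶ X} {b : ∀ i, Y ⟶ Z i} (h1 : ∀ i, a i ≫ f ≫ b i = 𝟙 (Z i))
    (h2 : ∀ i j, i ≠ j → a i ≫ f ≫ b j = 0) {κ : Type*} {W : κ → C}
    (hW : SplitsOff (f - f ≫ (∑ i, b i ≫ a i) ≫ f) W) :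
    SplitsOff f (Sum.elim Z W) := by
  classical
  set q := ∑ i, b i ≫ a i with hq
  have hqb : ∀ j, q ≫ f ≫ b j = b j := fun j => by
    rw [hq, Preadditive.sum_comp, Finset.sum_eq_single j]
    · rw [Category.assoc, h1, Category.comp_id]
    · intro i _ hij
      rw [Category.assoc, h2 i j hij, Limits.comp_zero]
    · simp
  have haq : ∀ i, a i ≫ f ≫ q = a i := fun i => by
    rw [hq, Preadditive.comp_sum, Preadditive.comp_sum, Finset.sum_eq_single i]
    · rw [← Category.assoc, ← Category.assoc, Category.assoc (a i), h1, Category.id_comp]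
    · intro j _ hij
      rw [← Category.assoc, ← Category.assoc, Category.assoc (a i), h2 i j hij.symm,
        Limits.zero_comp]
    · simp
  have hqfq : q ≫ f ≫ q = q := by
    conv_rhs => rw [hq]
    conv_lhs => rw [hq]
    rw [Preadditive.sum_comp]
    exact Finset.sum_congr rfl fun i _ => by rw [Category.assoc, ← hq, haq]
  obtain ⟨a', b', h1', h2'⟩ := hW
  -- Correcting `a'` by `1 - f ≫ q` and `b'` by `1 - q ≫ f` makes the new summands orthogonal to the
  -- old ones. Since `q ≫ f ≫ q = q`, the corrected maps pair through `f` exactly as the original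
  -- ones pair through the remainder.
  have key : ∀ i j, (a' i - a' i ≫ f ≫ q) ≫ f ≫ (b' j - q ≫ f ≫ b' j) =
      a' i ≫ (f - f ≫ q ≫ f) ≫ b' j := fun i j => by
    have h : q ≫ f ≫ q ≫ f ≫ b' j = q ≫ f ≫ b' j := by
      have := congrArg (fun t => t ≫ f ≫ b' j) hqfq
      simpa only [Category.assoc] using this
    simp only [Preadditive.sub_comp, Preadditive.comp_sub, Category.assoc, h]
    abel
  refine ⟨fun i => match i with
      | Sum.inl i => a i
      | Sum.inr i => a' i - a' i ≫ f ≫ q, fun i => match i with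
      | Sum.inl i => b i
      | Sum.inr i => b' i - q ≫ f ≫ b' i, ?_, ?_⟩
  · rintro (i | i)
    · exact h1 i
    · exact (key i i).trans (h1' i)
  · rintro (i | i) (j | j) hij
    · exact h2 i j (fun h => hij (h ▸ rfl))
    · change a i ≫ f ≫ (b' j - q ≫ f ≫ b' j) = 0
      have := congrArg (fun t => t ≫ f ≫ b' j) (haq i)
      simp only [Category.assoc] at this
      simp only [Preadditive.comp_sub, this, sub_self]
    · change (a' i - a' i ≫ f ≫ q) ≫ f ≫ b j = 0
      simp only [Preadditive.sub_comp, Category.assoc, hqb, sub_self]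
    · exact (key i j).trans (h2' i j (fun h => hij (h ▸ rfl)))

variable (k : Type w) [Field k] [Linear k C]

/-- Composition with `f ≫ b j` recovers the `j`-th coordinate of `∑ i, x i ≫ a i`, so the spaces
`Hom(g, Z i)` embed jointly. This is the upper bound that ends the maximality and growth arguments.
-/
lemma SplitsOff.sum_finrank_le {X Y : C} {f : X ⟶ Y} {ι : Type*} [Fintype ι] {Z : ι → C}
    (h : SplitsOff f Z) (g : C) [∀ X Y : C, Module.Finite k (X ⟶ Y)] :
    ∑ i, Module.finrank k (g ⟶ Z i) ≤ Module.finrank k (g ⟶ X) := by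
  classical
  obtain ⟨a, b, h1, h2⟩ := h
  rw [← Module.finrank_pi_fintype k]
  let L : (∀ i, g ⟶ Z i) →ₗ[k] (g ⟶ X) :=
    ∑ i, (Linear.rightComp k g (a i)).comp (LinearMap.proj i)
  have hL : ∀ x, L x = ∑ i, x i ≫ a i := fun x => by simp [L, LinearMap.sum_apply]
  refine LinearMap.finrank_le_finrank_of_injective (f := L) fun x y hxy => funext fun j => ?_
  have := congrArg (fun t => t ≫ f ≫ b j) hxy
  simp only [hL, Preadditive.sum_comp, Category.assoc] at this
  rwa [Finset.sum_eq_single j (fun i _ hij => by rw [h2 i j hij, Limits.comp_zero]) (by simp),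
    Finset.sum_eq_single j (fun i _ hij => by rw [h2 i j hij, Limits.comp_zero]) (by simp),
    h1, Category.comp_id, Category.comp_id] at this

/-- The rank of post-composition with `p` on morphisms from `g`. -/
noncomputable def homRank (g : C) {X Y : C} (p : X ⟶ Y) : ℕ :=
  Module.finrank k (LinearMap.range (Linear.rightComp k g p))

variable [∀ X Y : C, Module.Finite k (X ⟶ Y)]

/-- If every nonzero morphism `u` has an image `T u` through which the identity of `g` factors,
then the number of copies of `g` that split off `T p` grows linearly with the rank of `p`. -/
theorem exists_splitsOff_of_homRank (T : C ⥤ C) [T.Additive] [T.Linear k] {g : C}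
    (hg : 𝟙 g ≠ 0)
    (hT : ∀ {X Y : C} (u : X ⟶ Y), u ≠ 0 →
      ∃ (a : g ⟶ T.obj X) (b : T.obj Y ⟶ g), a ≫ T.map u ≫ b = 𝟙 g) {X Y : C} (p : X ⟶ Y) :
    ∃ r, SplitsOff (T.map p) (fun _ : Fin r => g) ∧
      homRank k g p ≤ r * Module.finrank k (T.obj g ⟶ g) := by
  classical
  let P : ℕ → Prop := fun r => SplitsOff (T.map p) (fun _ : Fin r => g)
  have hpos : 0 < Module.finrank k (g ⟶ g) := by
    have : Nontrivial (g ⟶ g) := ⟨⟨𝟙 g, 0, hg⟩⟩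
    exact Module.finrank_pos
  have hbound : ∀ r, P r → r ≤ Module.finrank k (g ⟶ T.obj X) := fun r hr => by
    have := hr.sum_finrank_le k g
    simp only [Finset.sum_const, Finset.card_univ, Fintype.card_fin, smul_eq_mul] at this
    exact (Nat.le_mul_of_pos_right r hpos).trans this
  have hP0 : P 0 := ⟨fun i => i.elim0, fun i => i.elim0, fun i => i.elim0, fun i => i.elim0⟩
  -- Take a maximal family of copies of `g`. It suffices that morphisms invisible to its projections
  -- are killed by `p`, for then the rank of `p` is at most that of `L`.
  let r := Nat.findGreatest P (Module.finrank k (g ⟶ T.obj X))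
  have hr : P r := Nat.findGreatest_spec (Nat.zero_le _) hP0
  refine ⟨r, hr, ?_⟩
  obtain ⟨a, b, h1, h2⟩ := hr
  let L : (g ⟶ X) →ₗ[k] (Fin r → (T.obj g ⟶ g)) := LinearMap.pi fun j =>
    (Linear.rightComp k _ (T.map p ≫ b j)).comp (T.mapLinearMap k)
  have hL : ∀ u j, L u j = T.map u ≫ T.map p ≫ b j := fun u j => rfl
  have hker : LinearMap.ker L ≤ LinearMap.ker (Linear.rightComp k g p) := by
    intro u hu
    by_contra hne
    -- A copy of `g` split off `T (u ≫ p)` enters along `T u`. The part already split off vanishes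
    -- there, so the remainder of `T p` would contain one more copy, against maximality.
    obtain ⟨a', b', hab⟩ := hT (u ≫ p) hne
    have hu' : ∀ j, T.map u ≫ T.map p ≫ b j = 0 := fun j => by
      rw [← hL, LinearMap.mem_ker.1 hu]; rfl
    have hrem : SplitsOff (T.map p - T.map p ≫ (∑ i, b i ≫ a i) ≫ T.map p)
        (fun _ : Fin 1 => g) := by
      refine ⟨fun _ => a' ≫ T.map u, fun _ => b', fun _ => ?_,
        fun i j hij => (hij (Subsingleton.elim i j)).elim⟩
      have hz : T.map u ≫ T.map p ≫ (∑ i, b i ≫ a i) ≫ T.map p ≫ b' = 0 := by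
        simp only [Preadditive.sum_comp, Preadditive.comp_sum, Category.assoc]
        refine Finset.sum_eq_zero fun i _ => ?_
        have := congrArg (fun t => t ≫ a i ≫ T.map p ≫ b') (hu' i)
        simpa using this
      simp only [Preadditive.sub_comp, Preadditive.comp_sub, Category.assoc, hz, Limits.comp_zero,
        sub_zero]
      simpa using hab
    have h3 := SplitsOff.exists_remainder h1 h2 hrem
    have h4 : P (r + 1) := by
      have := h3.reindex (e := finSumFinEquiv.symm) (Equiv.injective _)
      convert this using 2 with i
      rcases finSumFinEquiv.symm i with i | i <;> rfl
    exact absurd (Nat.le_findGreatest (hbound _ h4) h4) (by omega)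
  have e1 := LinearMap.finrank_range_add_finrank_ker L
  have e2 := LinearMap.finrank_range_add_finrank_ker (Linear.rightComp k g p)
  have e3 := Submodule.finrank_mono hker
  have e4 := Submodule.finrank_le (LinearMap.range L)
  rw [Module.finrank_pi_fintype, Finset.sum_const, Finset.card_univ, Fintype.card_fin,
    smul_eq_mul] at e4
  unfold homRank
  omega

/-- If `h` is not regular, then the rank of `f - f ≫ q ≫ f` grows linearly with the number of
copies of `h` that split off `f` in the category of arrows. -/
theorem exists_le_homRank_of_not_isRegularHom {g : C}
    (hg : ∀ X : C, ∃ (n : ℕ) (a : Fin n → (X ⟶ g)) (b : Fin n → (g ⟶ X)), ∑ i, a i ≫ b i = 𝟙 X)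
    {X Y : C} {h : X ⟶ Y} (hh : ¬ IsRegularHom h) :
    ∃ N : ℕ, ∀ {X' Y' : C} (f : X' ⟶ Y') (m : ℕ) (iX : Fin m → (X ⟶ X')) (rX : Fin m → (X' ⟶ X))
      (iY : Fin m → (Y ⟶ Y')) (rY : Fin m → (Y' ⟶ Y)), (∀ i, iX i ≫ f = h ≫ iY i) →
      (∀ i, f ≫ rY i = rX i ≫ h) → (∀ i, iY i ≫ rY i = 𝟙 Y) →
      (∀ i j, i ≠ j → iY i ≫ rY j = 0) → ∀ q : Y' ⟶ X',
        m ≤ N * homRank k g (f - f ≫ q ≫ f) := by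
  classical
  obtain ⟨n, s, t, hst⟩ := hg X
  -- Regularity of `h` is the linear condition that `h` lies in `h ≫ Hom(Y, X) ≫ h`. Its failure is
  -- therefore witnessed by a functional `φ` that vanishes on this subspace and takes the value `1`
  -- at `h`.
  let U : Submodule k (X ⟶ Y) :=
    LinearMap.range ((Linear.rightComp k X h).comp (Linear.leftComp k X h))
  have hU : ∀ x : Y ⟶ X, h ≫ x ≫ h ∈ U := fun x => ⟨x, by simp⟩
  have hhU : h ∉ U := by
    rintro ⟨x, hx⟩
    exact hh ⟨x, by simpa using hx⟩
  obtain ⟨φ₀, hφ₀, hφU₀⟩ := Submodule.exists_le_ker_of_notMem hhU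
  have hφ : ∃ φ : (X ⟶ Y) →ₗ[k] k, φ h = 1 ∧ U ≤ LinearMap.ker φ := by
    refine ⟨(φ₀ h)⁻¹ • φ₀, by simp [hφ₀], fun x hx => ?_⟩
    simp [LinearMap.mem_ker.1 (hφU₀ hx)]
  obtain ⟨φ, hφh, hφU⟩ := hφ
  -- The constant is the number of copies of `g` from which `X` splits off. It depends on neither
  -- `f`, `m` nor `q`.
  refine ⟨n, fun {X' Y'} f m iX rX iY rY hi hr hY hY' q => ?_⟩
  set p := f - f ≫ q ≫ f with hp
  let R := LinearMap.range (Linear.rightComp k g p)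
  let Ψ : (Fin n → R) →ₗ[k] (Fin m → k) := LinearMap.pi fun b => ∑ l,
    (φ ∘ₗ (Linear.leftComp k Y (s l)) ∘ₗ (Linear.rightComp k g (rY b)) ∘ₗ R.subtype) ∘ₗ
      LinearMap.proj l
  have hΨ : ∀ x b, Ψ x b = ∑ l, φ (s l ≫ (x l : g ⟶ Y') ≫ rY b) := fun x b => by
    simp [Ψ, LinearMap.sum_apply]
  have hpab : ∀ a b, iX a ≫ p ≫ rY b = iX a ≫ f ≫ rY b - h ≫ (iY a ≫ q ≫ rX b) ≫ h := by
    intro a b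
    have h1 : iX a ≫ f ≫ q ≫ f ≫ rY b = h ≫ iY a ≫ q ≫ rX b ≫ h := by
      rw [hr, ← Category.assoc, hi, Category.assoc]
    simp only [hp, Preadditive.sub_comp, Preadditive.comp_sub, Category.assoc, h1]
  -- Between the `a`-th and `b`-th copies, `p` is `h` or `0` according to whether `a = b`, up to an
  -- element of `U`. So `φ` sees the identity matrix whatever `q` is. The maps `s` and `t` rewrite
  -- morphisms from `X` as `n`-tuples of morphisms from `g`.
  have hsurj : Function.Surjective Ψ := by
    rw [← LinearMap.range_eq_top, eq_top_iff, ← (Pi.basisFun k (Fin m)).span_eq,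
      Submodule.span_le]
    rintro _ ⟨a, rfl⟩
    refine ⟨fun l => ⟨t l ≫ iX a ≫ p, ⟨t l ≫ iX a, by simp⟩⟩, funext fun b => ?_⟩
    have h1 : ∑ l, s l ≫ (t l ≫ iX a ≫ p) ≫ rY b = iX a ≫ p ≫ rY b := by
      have := congrArg (fun x => x ≫ iX a ≫ p ≫ rY b) hst
      simpa [Preadditive.sum_comp] using this
    rw [hΨ, ← map_sum, h1, hpab, map_sub, LinearMap.mem_ker.1 (hφU (hU _)), sub_zero,
      ← Category.assoc, hi, Category.assoc, Pi.basisFun_apply]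
    by_cases hab : a = b
    · subst hab
      rw [hY, Category.comp_id, hφh, Pi.single_eq_same]
    · rw [hY' a b hab, Limits.comp_zero, map_zero, Pi.single_eq_of_ne (Ne.symm hab)]
  have := LinearMap.finrank_le_finrank_of_surjective hsurj
  rw [Module.finrank_pi_fintype, Module.finrank_pi_fintype] at this
  simpa [homRank, R] using this

/-- A summand of copies of `g` is a summand of `dim Hom(g, Z)` copies. -/
lemma exists_sum_eq_id_finrank {g : C}
    (hg : ∀ X : C, ∃ (n : ℕ) (a : Fin n → (X ⟶ g)) (b : Fin n → (g ⟶ X)), ∑ i, a i ≫ b i = 𝟙 X)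
    (Z : C) : ∃ (a : Fin (Module.finrank k (g ⟶ Z)) → (Z ⟶ g))
      (b : Fin (Module.finrank k (g ⟶ Z)) → (g ⟶ Z)), ∑ i, a i ≫ b i = 𝟙 Z := by
  obtain ⟨n, a, b, hab⟩ := hg Z
  let B := Module.finBasis k (g ⟶ Z)
  -- Expand each `b i` in a basis of `Hom(g, Z)` and regroup: the basis vectors replace the `b i`,
  -- and the coefficients move to the `a i`.
  refine ⟨fun l => ∑ i, B.repr (b i) l • a i, B, ?_⟩
  rw [← hab]
  conv_rhs =>
    enter [2, i]
    rw [← B.sum_repr (b i), Preadditive.comp_sum]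
  rw [Finset.sum_comm]
  refine Finset.sum_congr rfl fun l _ => ?_
  rw [Preadditive.sum_comp]
  refine Finset.sum_congr rfl fun i _ => ?_
  simp

/-- `Z` is a summand of `dim Hom(g, Z)` copies of `g`, and `V` is additive. Applied to iterates of
one functor, this gives the submultiplicativity behind the growth argument. -/
lemma finrank_hom_map_le {g : C}
    (hg : ∀ X : C, ∃ (n : ℕ) (a : Fin n → (X ⟶ g)) (b : Fin n → (g ⟶ X)), ∑ i, a i ≫ b i = 𝟙 X)
    (V : C ⥤ C) [V.Additive] (Z : C) :
    Module.finrank k (g ⟶ V.obj Z) ≤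
      Module.finrank k (g ⟶ Z) * Module.finrank k (g ⟶ V.obj g) := by
  obtain ⟨a, b, hab⟩ := exists_sum_eq_id_finrank k hg Z
  let L : (Fin (Module.finrank k (g ⟶ Z)) → (g ⟶ V.obj g)) →ₗ[k] (g ⟶ V.obj Z) :=
    ∑ i, (Linear.rightComp k g (V.map (b i))).comp (LinearMap.proj i)
  have hL : ∀ x, L x = ∑ i, x i ≫ V.map (b i) := fun x => by simp [L, LinearMap.sum_apply]
  have := LinearMap.finrank_le_finrank_of_surjective (f := L) fun x => by
    refine ⟨fun i => x ≫ V.map (a i), ?_⟩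
    rw [hL]
    simp only [Category.assoc, ← V.map_comp]
    rw [← Preadditive.comp_sum, ← V.map_sum, hab, V.map_id, Category.comp_id]
  rwa [Module.finrank_pi_fintype, Finset.sum_const, Finset.card_univ, Fintype.card_fin,
    smul_eq_mul] at this

end Splits

/-! ## Finitary categories -/

/-- A nonzero idempotent endomorphism of a finitely generated projective module over an Artinian
ring dominates a nonzero direct summand that is also a direct summand of the regular module. -/
lemma exists_common_summand {A : Type*} [Ring A] [IsArtinianRing A] {P : Type*} [AddCommGroup P]
    [Module A P] [Module.Finite A P] [Module.Projective A P] (e : P →ₗ[A] P) (he : e ∘ₗ e = e)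
    (he0 : e ≠ 0) : ∃ (I : Submodule A P) (a : I →ₗ[A] P) (b : P →ₗ[A] I) (c : I →ₗ[A] A)
      (d : A →ₗ[A] I), I ≠ ⊥ ∧ b ∘ₗ e ∘ₗ a = LinearMap.id ∧ d ∘ₗ c = LinearMap.id := by
  let E := LinearMap.range e
  have hE : Nontrivial E := Submodule.nontrivial_iff_ne_bot.2 fun h =>
    he0 (LinearMap.range_eq_bot.1 h)
  obtain ⟨N, hN, -⟩ := (eq_top_or_exists_le_coatom (⊥ : Submodule A E)).resolve_left bot_ne_top
  have : IsSimpleModule A (E ⧸ N) := isSimpleModule_iff_isCoatom.2 hN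
  let p : P →ₗ[A] (E ⧸ N) := N.mkQ ∘ₗ e.rangeRestrict
  have hp : Function.Surjective p :=
    N.mkQ_surjective.comp (LinearMap.surjective_rangeRestrict e)
  have hpe : p ∘ₗ e = p := by
    ext x
    have : e.rangeRestrict (e x) = e.rangeRestrict x := Subtype.ext (LinearMap.congr_fun he x)
    simp [p, this]
  have : Nontrivial (E ⧸ N) := IsSimpleModule.nontrivial A _
  obtain ⟨m, hm⟩ := exists_ne (0 : E ⧸ N)
  let t : A →ₗ[A] (E ⧸ N) := LinearMap.toSpanSingleton A _ m
  have ht : Function.Surjective t := IsSimpleModule.toSpanSingleton_surjective A hm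
  obtain ⟨ψ, hψ⟩ := Module.projective_lifting_property t p ht
  obtain ⟨φ, hφ⟩ := Module.projective_lifting_property p t hp
  -- Both `P` and `A` cover the simple quotient of the image of `e`, and projectivity lifts the
  -- covers to `ψ` and `φ`. The endomorphism `x` factors through `A`, has image inside that of `e`,
  -- and induces the identity on the nonzero simple module, so none of its powers vanishes.
  let x : Module.End A P := e ∘ₗ φ ∘ₗ ψ
  have hpx : ∀ z, p (x z) = p z := fun z => by
    have h1 := LinearMap.congr_fun hpe (φ (ψ z))
    have h2 := LinearMap.congr_fun hφ (ψ z)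
    have h3 := LinearMap.congr_fun hψ z
    simp only [LinearMap.comp_apply] at h1 h2 h3
    simp only [x, LinearMap.comp_apply]
    rw [h1, h2, h3]
  -- By Fitting's lemma a high power of `x` restricts to an automorphism of its image, which is the
  -- required summand. The exponent must be at least `1` for that power still to factor through `A`
  -- and to land in the image of `e`.
  obtain ⟨n, hn, hc⟩ := ((Filter.eventually_ge_atTop 1).and
    (LinearMap.eventually_isCompl_ker_pow_range_pow x)).exists
  obtain ⟨n, rfl⟩ : ∃ l, n = l + 1 := ⟨n - 1, by omega⟩
  set y : P →ₗ[A] P := x ^ (n + 1) with hy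
  let I := LinearMap.range y
  let j : I →ₗ[A] P := I.subtype
  let π : P →ₗ[A] I := y.rangeRestrict
  have hjπ : j ∘ₗ π = y := rfl
  have hey : e ∘ₗ y = y := by
    ext z
    have h := LinearMap.congr_fun he (φ (ψ ((x ^ n) z)))
    rw [hy, pow_succ']
    exact h
  have hpy : ∀ l z, p ((x ^ l) z) = p z := by
    intro l
    induction l with
    | zero => intro z; rfl
    | succ l ih => intro z; rw [pow_succ']; exact (hpx _).trans (ih z)
  have hI : I ≠ ⊥ := by
    intro h
    obtain ⟨z, hz⟩ := hp m
    have h0 : y z = 0 := by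
      have : y z ∈ I := ⟨z, rfl⟩
      rwa [h] at this
    exact hm (by rw [← hz, ← hpy (n + 1) z, ← hy, h0, map_zero])
  have hinj : Function.Injective (π ∘ₗ j) := by
    rw [← LinearMap.ker_eq_bot, LinearMap.ker_eq_bot']
    intro z hz
    have hz' : y z = 0 := congrArg Subtype.val hz
    exact Subtype.ext ((Submodule.disjoint_def.1 hc.disjoint) z hz' z.2)
  let σ : I ≃ₗ[A] I := LinearEquiv.ofBijective (π ∘ₗ j)
    (IsArtinian.bijective_of_injective_endomorphism _ hinj)
  have hσ : ∀ z, σ z = π (j z) := fun z => rfl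
  refine ⟨I, j, σ.symm ∘ₗ π, ψ ∘ₗ (x ^ n : Module.End A P) ∘ₗ j,
    σ.symm.toLinearMap ∘ₗ σ.symm.toLinearMap ∘ₗ π ∘ₗ e ∘ₗ φ, hI, ?_, ?_⟩
  · ext z
    have hz : e (j z) = j z := by
      obtain ⟨z', hz'⟩ := z.2
      change e z.1 = z.1
      rw [← hz']
      exact LinearMap.congr_fun hey z'
    simp only [LinearMap.comp_apply, hz, LinearMap.id_apply]
    exact congrArg _ (σ.symm_apply_apply z)
  · ext z
    have hz : e (φ (ψ ((x ^ n) (j z)))) = y (j z) := by rw [hy, pow_succ']; rfl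
    have hz' : π (y (j z)) = σ (σ z) := rfl
    simp only [LinearMap.comp_apply, LinearEquiv.coe_coe, hz, hz', LinearEquiv.symm_apply_apply,
      LinearMap.id_apply]

lemma SplitsOff.of_fullyFaithful {C D : Type*} [Category* C] [Category* D] [Preadditive C]
    [Preadditive D] (F : C ⥤ D) [F.Full] [F.Faithful] [F.Additive] {ι : Type*} {Z : ι → C} {Y : C}
    {f : Y ⟶ Y} {Q : D} {f' : Q ⟶ Q} (h : SplitsOff f' fun i => F.obj (Z i)) (i : F.obj Y ≅ Q)
    (hi : F.map f = i.hom ≫ f' ≫ i.inv) : SplitsOff f Z := by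
  obtain ⟨a, b, h1, h2⟩ := h
  refine ⟨fun l => F.preimage (a l ≫ i.inv), fun l => F.preimage (i.hom ≫ b l), fun l => ?_,
    fun l l' hl => ?_⟩
  · apply F.map_injective
    simpa [hi] using h1 l
  · apply F.map_injective
    simpa [hi] using h2 l l' hl

/-- In a finitary category every object has multiples. -/
lemma IsFinitary.exists_power (k : Type w) [Field k] {C : Type u} [Category.{v} C]
    [Preadditive C] [Linear k C] [IsFinitary k C] (X : C) (D : ℕ) :
    ∃ Y : C, SplitsOff (𝟙 Y) fun _ : Fin D => X := by
  obtain ⟨A, _, _, _, e, he, he'⟩ := IsFinitary.exists_equivalence (k := k) (C := C)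
  obtain ⟨hP, hP'⟩ := (e.functor.obj X).property
  have : Module.Projective A (Fin D → (e.functor.obj X).obj) :=
    Module.Projective.of_equiv (DFinsupp.linearEquivFunOnFintype (R := A))
  let Q : FinProj A := ⟨ModuleCat.of A (Fin D → (e.functor.obj X).obj), inferInstance, this⟩
  refine ⟨e.inverse.obj Q, SplitsOff.of_fullyFaithful e.functor (f' := 𝟙 Q) ?_
    (e.counitIso.app Q) (by simp)⟩
  refine ⟨fun i => ObjectProperty.homMk (ModuleCat.ofHom
      (LinearMap.single A (fun _ => (e.functor.obj X).obj) i)),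
    fun i => ObjectProperty.homMk (ModuleCat.ofHom (LinearMap.proj i)), fun i => ?_,
    fun i j hij => ?_⟩
  · ext x
    exact Pi.single_eq_same (M := fun _ => (e.functor.obj X).obj) i x
  · ext x
    exact Pi.single_eq_of_ne (M := fun _ => (e.functor.obj X).obj) hij.symm x

/-- A finitary category has an object that shares a nonzero summand with every nonzero
idempotent. -/
lemma IsFinitary.exists_common_summand (k : Type w) [Field k] (C : Type u) [Category.{v} C]
    [Preadditive C] [Linear k C] [IsFinitary k C] : ∃ α : C, ∀ (G : C) (e : G ⟶ G), e ≫ e = e → e ≠ 0 →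
    ∃ I : C, 𝟙 I ≠ 0 ∧ SplitsOff e (fun _ : Fin 1 => I) ∧ Nonempty (Retract I α) := by
  obtain ⟨A, _, _, _, E, hE, hE'⟩ := IsFinitary.exists_equivalence (k := k) (C := C)
  have : IsArtinianRing A := IsArtinianRing.of_finite k A
  let R : FinProj A := ⟨ModuleCat.of A A, inferInstance, inferInstance⟩
  -- The common object corresponds to the regular module.
  refine ⟨E.inverse.obj R, fun G e he he0 => ?_⟩
  obtain ⟨hP, hP'⟩ := (E.functor.obj G).property
  obtain ⟨I, a, b, c, d, hI, hab, hcd⟩ := SgCat.exists_common_summand (E.functor.map e).hom.hom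
    (by
      have := congrArg (fun f => (E.functor.map f).hom.hom) he
      simpa using this)
    (fun h => he0 (E.functor.map_injective (by
      rw [E.functor.map_zero]
      ext x
      exact LinearMap.congr_fun h x)))
  have hIf : Module.Finite A I := Module.Finite.of_surjective d fun x =>
    ⟨c x, LinearMap.congr_fun hcd x⟩
  have hIp : Module.Projective A I := Module.Projective.of_split c d hcd
  let J : FinProj A := ⟨ModuleCat.of A I, hIf, hIp⟩
  let i : E.functor.obj (E.inverse.obj J) ≅ J := E.counitIso.app J
  refine ⟨E.inverse.obj J, fun h0 => ?_, ?_, ⟨?_⟩⟩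
  · have h1 : 𝟙 J = 0 := by
      have h2 : E.functor.map (𝟙 (E.inverse.obj J)) = 0 := by rw [h0, E.functor.map_zero]
      calc 𝟙 J = i.inv ≫ E.functor.map (𝟙 (E.inverse.obj J)) ≫ i.hom := by
            rw [E.functor.map_id]
            simp
        _ = 0 := by rw [h2, Limits.zero_comp, Limits.comp_zero]
    refine hI ((Submodule.eq_bot_iff I).2 fun x hx => ?_)
    exact congrArg Subtype.val (LinearMap.congr_fun (congrArg (fun f => f.hom.hom) h1) ⟨x, hx⟩)
  · have h : SplitsOff (E.functor.map e) fun _ : Fin 1 => J := by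
      refine ⟨fun _ => ObjectProperty.homMk (ModuleCat.ofHom a),
        fun _ => ObjectProperty.homMk (ModuleCat.ofHom b), fun _ => ?_,
        fun i j hij => (hij (Subsingleton.elim i j)).elim⟩
      ext x
      exact congrArg Subtype.val (LinearMap.congr_fun hab x)
    obtain ⟨a', b', h1, -⟩ := h
    refine SplitsOff.of_fullyFaithful E.functor (f' := E.functor.map e) ?_ (Iso.refl _) (by simp)
    refine ⟨fun l => i.hom ≫ a' l, fun l => b' l ≫ i.inv, fun l => ?_,
      fun i j hij => (hij (Subsingleton.elim i j)).elim⟩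
    have := congrArg (fun t => i.hom ≫ t ≫ i.inv) (h1 l)
    simpa using this
  · have r : Retract J R :=
      { i := ObjectProperty.homMk (ModuleCat.ofHom c)
        r := ObjectProperty.homMk (ModuleCat.ofHom d)
        retract := by
          ext x
          exact congrArg Subtype.val (LinearMap.congr_fun hcd x) }
    exact r.map E.inverse

/-- Every object of a finitary category is a direct sum of nonzero summands of one object. -/
lemma IsFinitary.exists_decomposition (k : Type w) [Field k] (C : Type u) [Category.{v} C]
    [Preadditive C] [Linear k C] [IsFinitary k C] : ∃ α : C, ∀ G : C, ∃ (q : ℕ) (I : Fin q → C)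
    (a : ∀ i, I i ⟶ G) (b : ∀ i, G ⟶ I i), (∀ i, 𝟙 (I i) ≠ 0) ∧ (∀ i, Nonempty (Retract (I i) α)) ∧
      (∀ i, a i ≫ b i = 𝟙 (I i)) ∧ (∀ i j, i ≠ j → a i ≫ b j = 0) ∧ ∑ i, b i ≫ a i = 𝟙 G := by
  classical
  obtain ⟨g, hfin, hg⟩ := IsFinitary.exists_generator k C
  obtain ⟨α, hα⟩ := IsFinitary.exists_common_summand k C
  refine ⟨α, fun G => ?_⟩
  let P : ℕ → Prop := fun q => ∃ I : Fin q → C, (∀ i, 𝟙 (I i) ≠ 0) ∧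
    (∀ i, Nonempty (Retract (I i) α)) ∧ SplitsOff (𝟙 G) I
  have hbound : ∀ q, P q → q ≤ Module.finrank k (g ⟶ G) := by
    rintro q ⟨I, hI, -, hs⟩
    refine le_trans ?_ (hs.sum_finrank_le k g)
    have : ∀ i, 1 ≤ Module.finrank k (g ⟶ I i) := fun i => by
      by_contra hlt
      have h0 : Module.finrank k (g ⟶ I i) = 0 := by omega
      have := Module.finrank_zero_iff.1 h0
      obtain ⟨n, a, b, hab⟩ := hg (I i)
      refine hI i ?_
      rw [← hab]
      exact Finset.sum_eq_zero fun l _ => by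
        rw [Subsingleton.elim (b l) 0, Limits.comp_zero]
    calc q = ∑ i : Fin q, 1 := by simp
      _ ≤ _ := Finset.sum_le_sum fun i _ => this i
  have hP0 : P 0 := ⟨fun i => i.elim0, fun i => i.elim0, fun i => i.elim0, fun i => i.elim0,
    fun i => i.elim0, fun i => i.elim0, fun i => i.elim0⟩
  let q := Nat.findGreatest P (Module.finrank k (g ⟶ G))
  have hq : P q := Nat.findGreatest_spec (Nat.zero_le _) hP0
  obtain ⟨I, hI, hIα, a, b, h1, h2⟩ := hq
  have h1' : ∀ i, a i ≫ b i = 𝟙 _ := fun i => by simpa using h1 i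
  have h2' : ∀ i j, i ≠ j → a i ≫ b j = 0 := fun i j hij => by simpa using h2 i j hij
  refine ⟨q, I, a, b, hI, hIα, h1', h2', ?_⟩
  by_contra hne
  set s := ∑ i, b i ≫ a i with hs
  have has : ∀ i, a i ≫ s = a i := fun i => by
    rw [hs, Preadditive.comp_sum, Finset.sum_eq_single i]
    · rw [← Category.assoc, h1', Category.id_comp]
    · intro j _ hij
      rw [← Category.assoc, h2' i j hij.symm, Limits.zero_comp]
    · simp
  have hss : s ≫ s = s := by
    conv_lhs => rw [hs, Preadditive.sum_comp, ← hs]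
    conv_rhs => rw [hs]
    exact Finset.sum_congr rfl fun i _ => by rw [Category.assoc, has]
  -- If the maximal family does not exhaust `G`, the complementary idempotent is nonzero and yields
  -- one more summand.
  obtain ⟨J, hJ, hsplit, hJα⟩ := hα G (𝟙 G - s) (by simp [Preadditive.sub_comp,
    Preadditive.comp_sub, hss]) (fun h => hne (sub_eq_zero.1 h).symm)
  have h3 := SplitsOff.exists_remainder (f := 𝟙 G) h1 h2 (W := fun _ : Fin 1 => J)
    (by simpa only [Category.comp_id, Category.id_comp] using hsplit)
  have h4 : P (q + 1) := by
    refine ⟨_, fun i => ?_, fun i => ?_,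
      h3.reindex (e := finSumFinEquiv.symm) (Equiv.injective _)⟩
    · rcases finSumFinEquiv.symm i with i | i
      exacts [hI i, hJ]
    · rcases finSumFinEquiv.symm i with i | i
      exacts [hIα i, hJα]
  exact absurd (Nat.le_findGreatest (hbound _ h4) h4) (by omega)

/-! ## A growth argument for regularity -/

section Growth

variable {C : Type u} [Category.{v} C]

/-- The iterates of an endofunctor. -/
def iterFunctor (T : C ⥤ C) : ℕ → (C ⥤ C)
  | 0 => 𝟭 C
  | n + 1 => iterFunctor T n ⋙ T

lemma iterFunctor_add_obj (T : C ⥤ C) (m n : ℕ) (X : C) :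
    (iterFunctor T (m + n)).obj X = (iterFunctor T n).obj ((iterFunctor T m).obj X) := by
  induction n with
  | zero => rfl
  | succ n ih => exact congrArg T.obj ih

variable [Preadditive C]

instance iterFunctor_additive (T : C ⥤ C) [T.Additive] (n : ℕ) : (iterFunctor T n).Additive := by
  induction n with
  | zero => exact inferInstanceAs (𝟭 C).Additive
  | succ n ih => exact inferInstanceAs (iterFunctor T n ⋙ T).Additive

variable (k : Type w) [Field k] [Linear k C] [∀ X Y : C, Module.Finite k (X ⟶ Y)]

/-- If `U` is a direct summand of the powers of `T` with multiplicities of the same growth as the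
powers themselves, then all morphisms in the image of `U` are regular: the nonregular part of the
image of `f` under `T ^ n` would split off too many summands. -/
theorem isRegularHom_map_of_growth (T U : C ⥤ C) [T.Additive] [T.Linear k] {g : C}
    (hg : ∀ X : C, ∃ (n : ℕ) (a : Fin n → (X ⟶ g)) (b : Fin n → (g ⟶ X)), ∑ i, a i ≫ b i = 𝟙 X)
    (hg0 : 𝟙 g ≠ 0)
    (hT : ∀ {X Y : C} (u : X ⟶ Y), u ≠ 0 →
      ∃ (a : g ⟶ T.obj X) (b : T.obj Y ⟶ g), a ≫ T.map u ≫ b = 𝟙 g)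
    (B : ℕ) (hU : ∀ n, ∃ (q : ℕ) (α : Fin q → (U ⟶ T ⋙ iterFunctor T (n + 2)))
      (β : Fin q → (T ⋙ iterFunctor T (n + 2) ⟶ U)),
      Module.finrank k (g ⟶ (iterFunctor T (n + 1)).obj g) ≤ B * q ∧
      (∀ i, α i ≫ β i = 𝟙 U) ∧ ∀ i j, i ≠ j → α i ≫ β j = 0) {X Y : C} (f : X ⟶ Y) :
    IsRegularHom (U.map f) := by
  classical
  by_contra hf
  obtain ⟨N, hN⟩ := exists_le_homRank_of_not_isRegularHom k hg hf
  set m : ℕ → ℕ := fun n => Module.finrank k (g ⟶ (iterFunctor T n).obj g) with hm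
  have hm_add : ∀ a b, m (a + b) ≤ m a * m b := fun a b => by
    have := finrank_hom_map_le k hg (iterFunctor T b) ((iterFunctor T a).obj g)
    rwa [← iterFunctor_add_obj] at this
  have hm_pos : ∀ n, 0 < m n := by
    intro n
    have hne : ∀ n, 𝟙 ((iterFunctor T n).obj g) ≠ 0 := by
      intro n
      induction n with
      | zero => exact hg0
      | succ n ih =>
        obtain ⟨a, b, hab⟩ := hT _ ih
        intro h0
        change 𝟙 (T.obj ((iterFunctor T n).obj g)) = 0 at h0
        rw [T.map_id, h0, Limits.zero_comp, Limits.comp_zero] at hab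
        exact hg0 hab.symm
    obtain ⟨l, a, b, hab⟩ := hg ((iterFunctor T n).obj g)
    refine Nat.pos_of_ne_zero fun h0 => hne n ?_
    have := Module.finrank_zero_iff.1 h0
    rw [← hab]
    exact Finset.sum_eq_zero fun i _ => by rw [Subsingleton.elim (b i) 0, Limits.comp_zero]
  set c := Module.finrank k (T.obj g ⟶ g) with hc
  -- `F n` is `T ^ (n + 3)` applied to `f`, bracketed so that `F (n + 1)` is definitionally `T.map
  -- (F n)` and the transformations in `hU` apply directly.
  let F : ∀ n, (iterFunctor T (n + 2)).obj (T.obj X) ⟶ (iterFunctor T (n + 2)).obj (T.obj Y) :=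
    fun n => (iterFunctor T (n + 2)).map (T.map f)
  -- The `q` copies of the nonregular `U.map f` inside `F n` force every remainder to have rank at
  -- least proportional to `q`, hence to `m (n + 1)`.
  have hrank : ∀ n Q, m (n + 1) ≤ B * (N * homRank k g (F n - F n ≫ Q ≫ F n)) := fun n Q => by
    obtain ⟨q, α, β, hq, h1, h2⟩ := hU n
    refine hq.trans (Nat.mul_le_mul_left _ ?_)
    refine hN (F n) q (fun i => (α i).app X) (fun i => (β i).app X) (fun i => (α i).app Y)
      (fun i => (β i).app Y) (fun i => ((α i).naturality f).symm) (fun i => (β i).naturality f)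
      (fun i => ?_) (fun i j hij => ?_) Q
    · exact congrArg (fun t => t.app Y) (h1 i)
    · exact congrArg (fun t => t.app Y) (h2 i j hij)
  set K := B * N * c with hK
  -- The exponent `e x` is the age of a summand: the number of times `T` was applied since it was
  -- split off as a copy of `g`. The generation born at stage `n + 1` has `r` members with `m (n +
  -- 1) ≤ K * r`, so after `i` further steps submultiplicativity gives `m (n + 1 + i) ≤ K * (r * m
  -- i)`. The bound is required for all shifts `i` because each induction step ages the older
  -- generations by one.
  have main : ∀ n, ∃ (ι : Type) (_ : Fintype ι) (e : ι → ℕ),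
      SplitsOff (F n) (fun x => (iterFunctor T (e x)).obj g) ∧
        ∀ i, n * m (n + i) ≤ K * ∑ x, m (e x + i) := by
    intro n
    induction n with
    | zero =>
      exact ⟨Empty, inferInstance, fun x => x.elim,
        ⟨fun i => i.elim, fun i => i.elim, fun i => i.elim, fun i => i.elim⟩, fun i => by simp⟩
    | succ n ih =>
      obtain ⟨ι, _, e, ⟨a, b, h1, h2⟩, hsum⟩ := ih
      set Q := ∑ x, b x ≫ a x with hQ
      obtain ⟨r, hr, hrk⟩ := exists_splitsOff_of_homRank k T hg0 hT (F n - F n ≫ Q ≫ F n)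
      have h3 : ∀ x, T.map (a x) ≫ T.map (F n) ≫ T.map (b x) = 𝟙 _ := fun x => by
        rw [← T.map_comp, ← T.map_comp, h1, T.map_id]
      have h4 : ∀ x y, x ≠ y → T.map (a x) ≫ T.map (F n) ≫ T.map (b y) = 0 := fun x y hxy => by
        rw [← T.map_comp, ← T.map_comp, h2 x y hxy, T.map_zero]
      have hQT : T.map (F n - F n ≫ Q ≫ F n) =
          T.map (F n) - T.map (F n) ≫ (∑ x, T.map (b x) ≫ T.map (a x)) ≫ T.map (F n) := by
        rw [T.map_sub, T.map_comp, T.map_comp, hQ, T.map_sum]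
        simp only [T.map_comp]
      rw [hQT] at hr
      have h5 := SplitsOff.exists_remainder h3 h4 hr
      refine ⟨ι ⊕ Fin r, inferInstance, Sum.elim (fun x => e x + 1) (fun _ => 0), ?_, fun i => ?_⟩
      · change SplitsOff (T.map (F n)) _
        convert h5 using 2 with x
        rcases x with x | x <;> rfl
      · have h6 := hsum (1 + i)
        have h7 : m (n + 1) ≤ K * r := by
          refine (hrank n Q).trans ?_
          calc B * (N * homRank k g (F n - F n ≫ Q ≫ F n)) ≤ B * (N * (r * c)) := by gcongr
            _ = K * r := by rw [hK]; ring
        have h8 : m (n + 1 + i) ≤ K * (r * m i) :=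
          (hm_add _ _).trans ((Nat.mul_le_mul_right _ h7).trans_eq (by ring))
        rw [Fintype.sum_sum_type]
        simp only [Sum.elim_inl, Sum.elim_inr, Finset.sum_const, Finset.card_univ,
          Fintype.card_fin, smul_eq_mul, zero_add]
        simp only [← add_assoc] at h6
        rw [Nat.mul_add, Nat.add_mul, one_mul]
        exact Nat.add_le_add h6 h8
  -- All summands of `F n` together fit into a space of dimension at most `s * m 2 * m n`, whereas
  -- `n` generations need `n * m n / K`. The first `n` beyond `K * (s * m 2)` gives the
  -- contradiction.
  set s := Module.finrank k (g ⟶ T.obj X) with hs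
  obtain ⟨ι, _, e, hsplit, hsum⟩ := main (K * (s * m 2) + 1)
  set n := K * (s * m 2) + 1 with hn
  have h1 : ∑ x, m (e x) ≤ s * m (n + 2) := (hsplit.sum_finrank_le k g).trans
    (finrank_hom_map_le k hg (iterFunctor T (n + 2)) (T.obj X))
  have h2 : n * m n ≤ (K * (s * m 2)) * m n := by
    calc n * m n ≤ K * ∑ x, m (e x) := by simpa using hsum 0
      _ ≤ K * (s * (m n * m 2)) := by
        gcongr
        exact h1.trans (Nat.mul_le_mul_left _ (hm_add _ _))
      _ = (K * (s * m 2)) * m n := by ring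
  have := Nat.le_of_mul_le_mul_right h2 (hm_pos n)
  omega

end Growth

/-! ### Factorizations through images of additive functors, and dimension bounds -/

section Factorization

variable (k : Type w) [Field k] {C : Type u₁} [Category.{v₁} C] [Preadditive C] {D : Type u}
  [Category.{v} D] [Preadditive D] [Linear k D]

/-- Morphisms that factor through `V X` are sums of morphisms that factor through `V γ`, if `γ` is
an additive generator. -/
lemma comp_mem_span_of_generator {γ : C}
    (hγ : ∀ X : C, ∃ (n : ℕ) (a : Fin n → (X ⟶ γ)) (b : Fin n → (γ ⟶ X)), ∑ i, a i ≫ b i = 𝟙 X)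
    (V : C ⥤ D) [V.Additive] {X : C} {W W' : D} (p : W ⟶ V.obj X) (q : V.obj X ⟶ W') :
    p ≫ q ∈ Submodule.span k {t | ∃ (p' : W ⟶ V.obj γ) (q' : V.obj γ ⟶ W'), t = p' ≫ q'} := by
  obtain ⟨n, a, b, hab⟩ := hγ X
  have : p ≫ q = ∑ i, (p ≫ V.map (a i)) ≫ V.map (b i) ≫ q := by
    have h := congrArg (fun t => p ≫ V.map t ≫ q) hab
    simp only [V.map_sum, Preadditive.sum_comp, Preadditive.comp_sum, V.map_id, Category.id_comp,
      V.map_comp, Category.assoc] at h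
    simp only [Category.assoc]
    exact h.symm
  rw [this]
  exact Submodule.sum_mem _ fun i _ => Submodule.subset_span ⟨_, _, rfl⟩

/-- A sum of `n` factorizations through `V X` is a row times a column, hence one factorization
through `V Y` as soon as `Y` contains `n` orthogonal copies of `X`. -/
lemma exists_factorization_of_sum {n : ℕ} {X Y : C} (hY : SplitsOff (𝟙 Y) fun _ : Fin n => X)
    (V : C ⥤ D) [V.Additive] {W : D} (p : Fin n → (W ⟶ V.obj X)) (q : Fin n → (V.obj X ⟶ W))
    (hpq : ∑ i, p i ≫ q i = 𝟙 W) : ∃ (p' : W ⟶ V.obj Y) (q' : V.obj Y ⟶ W), p' ≫ q' = 𝟙 W := by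
  obtain ⟨a, b, h1, h2⟩ := hY
  refine ⟨∑ i, p i ≫ V.map (a i), ∑ j, V.map (b j) ≫ q j, ?_⟩
  rw [Preadditive.sum_comp, ← hpq]
  refine Finset.sum_congr rfl fun i _ => ?_
  rw [Preadditive.comp_sum, Finset.sum_eq_single i]
  · have := h1 i
    rw [Category.id_comp] at this
    rw [Category.assoc, ← Category.assoc (V.map _), ← V.map_comp, this, V.map_id, Category.id_comp]
  · intro j _ hij
    have := h2 i j hij.symm
    rw [Category.id_comp] at this
    rw [Category.assoc, ← Category.assoc (V.map _), ← V.map_comp, this, V.map_zero,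
      Limits.zero_comp, Limits.comp_zero]
  · simp

variable [∀ X Y : D, Module.Finite k (X ⟶ Y)]

lemma finrank_hom_map_le_sum (V : C ⥤ D) [V.Additive] {G : C} {q : ℕ} {I : Fin q → C}
    (a : ∀ i, I i ⟶ G) (b : ∀ i, G ⟶ I i) (hab : ∑ i, b i ≫ a i = 𝟙 G) (g : D) :
    Module.finrank k (g ⟶ V.obj G) ≤ ∑ i, Module.finrank k (g ⟶ V.obj (I i)) := by
  rw [← Module.finrank_pi_fintype k]
  let L : (∀ i, g ⟶ V.obj (I i)) →ₗ[k] (g ⟶ V.obj G) :=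
    ∑ i, (Linear.rightComp k g (V.map (a i))).comp (LinearMap.proj i)
  have hL : ∀ x, L x = ∑ i, x i ≫ V.map (a i) := fun x => by simp [L, LinearMap.sum_apply]
  refine LinearMap.finrank_le_finrank_of_surjective (f := L) fun x => ?_
  refine ⟨fun i => x ≫ V.map (b i), ?_⟩
  rw [hL]
  simp only [Category.assoc, ← V.map_comp]
  rw [← Preadditive.comp_sum, ← V.map_sum, hab, V.map_id, Category.comp_id]

lemma finrank_hom_le_of_retract {X Y : D} (r : Retract X Y) (g : D) :
    Module.finrank k (g ⟶ X) ≤ Module.finrank k (g ⟶ Y) := by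
  refine LinearMap.finrank_le_finrank_of_injective (f := Linear.rightComp k g r.i)
    fun x y hxy => ?_
  have := congrArg (fun t => t ≫ r.r) hxy
  simpa using this

end Factorization

/-! ### The action as functors, and two stable ideals -/

section Action

variable {S : Type u₁} [Category.{v₁} S] [Preadditive S] [SemigroupCategory S]
  {M : Type u} [Category.{v} M] [Preadditive M] [ModuleCategory S M]

/-- The functor `F ↦ F ⊠ G`. -/
def tensorRightFunctor (G : S) : S ⥤ S where
  obj F := F ⊠ G
  map f := f ▷ₛ G
  map_id F := id_whiskerRight F G
  map_comp f f' := comp_whiskerRight f f' G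

/-- The functor `G ↦ F ⊠ G`. -/
def tensorLeftFunctor (F : S) : S ⥤ S where
  obj G := F ⊠ G
  map g := F ◁ₛ g
  map_id G := whiskerLeft_id F G
  map_comp g g' := whiskerLeft_comp F g g'

/-- The functor `F ↦ F ⋆ X`. -/
def actOnFunctor (X : M) : S ⥤ M where
  obj F := F ⋆ X
  map f := actRight f X
  map_id F := actRight_id F X
  map_comp f g := actRight_comp f g X

lemma tensorRightFunctor_additive (k : Type w) [Field k] [Linear k S]
    [SemigroupCategory.IsLinear k S] (G : S) : (tensorRightFunctor G).Additive :=
  ⟨SemigroupCategory.IsLinear.add_whiskerRight k _ _ G⟩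

lemma tensorLeftFunctor_additive (k : Type w) [Field k] [Linear k S]
    [SemigroupCategory.IsLinear k S] (F : S) : (tensorLeftFunctor F).Additive :=
  ⟨SemigroupCategory.IsLinear.whiskerLeft_add k F _ _⟩

lemma actOnFunctor_additive (k : Type w) [Field k] [Linear k S] [Linear k M]
    [ModuleCategory.IsLinear k S M] (X : M) : (actOnFunctor (S := S) X).Additive :=
  ⟨ModuleCategory.IsLinear.actRight_add k _ _ X⟩

lemma actTrans_comp {F G H : S} (f : F ⟶ G) (g : G ⟶ H) :
    actTrans (M := M) (f ≫ g) = actTrans f ≫ actTrans g := by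
  ext X
  exact actRight_comp f g X

lemma actTrans_id (F : S) : actTrans (M := M) (𝟙 F) = 𝟙 _ := by
  ext X
  exact actRight_id F X

lemma actTrans_zero (k : Type w) [Field k] [Linear k S] [Linear k M]
    [ModuleCategory.IsLinear k S M] (F G : S) : actTrans (M := M) (0 : F ⟶ G) = 0 := by
  ext X
  have := actOnFunctor_additive (S := S) k X
  exact (actOnFunctor X).map_zero F G

lemma actLeft_actLeft (G F : S) {X Y : M} (x : X ⟶ Y) :
    actLeft G (actLeft F x) = (mult G F X).inv ≫ actLeft (G ⊠ F) x ≫ (mult G F Y).hom := by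
  rw [mult_naturality_right, Iso.inv_hom_id_assoc]

variable (k : Type w) [Field k] [Linear k S] [Linear k M] [ModuleCategory.IsLinear k S M]

variable (S M) in
/-- The morphisms annihilated by `S`. -/
def annihilatorIdeal : StableIdeal k S M where
  hom X Y := ⨅ F : S, LinearMap.ker
    (haveI := (actFunctor_additive k M F).1
     haveI := (actFunctor_additive k M F).2
     ((actFunctor M F).mapLinearMap k : (X ⟶ Y) →ₗ[k] _))
  comp_mem f g hg := by
    simp only [Submodule.mem_iInf, LinearMap.mem_ker] at hg ⊢
    intro F
    have := hg F
    change actLeft F g = 0 at this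
    change actLeft F (f ≫ g) = 0
    rw [actLeft_comp, this, Limits.comp_zero]
  mem_comp {X Y Z f} g hf := by
    simp only [Submodule.mem_iInf, LinearMap.mem_ker] at hf ⊢
    intro F
    have := hf F
    change actLeft F f = 0 at this
    change actLeft F (f ≫ g) = 0
    rw [actLeft_comp, this, Limits.zero_comp]
  act_mem G {X Y f} hf := by
    simp only [Submodule.mem_iInf, LinearMap.mem_ker] at hf ⊢
    intro F
    have := hf (F ⊠ G)
    change actLeft (F ⊠ G) f = 0 at this
    change actLeft F (actLeft G f) = 0
    rw [actLeft_actLeft, this, Limits.zero_comp, Limits.comp_zero]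

lemma mem_annihilatorIdeal {X Y : M} (f : X ⟶ Y) :
    f ∈ (annihilatorIdeal S M k).hom X Y ↔ ∀ F : S, actLeft F f = 0 := by
  simp only [annihilatorIdeal, Submodule.mem_iInf, LinearMap.mem_ker]
  rfl

variable (S) in
/-- The stable ideal generated by the images of a morphism under the action. -/
def generatedIdeal {X Y : M} (u : X ⟶ Y) : StableIdeal k S M where
  hom A B := Submodule.span k
    {t | ∃ (F : S) (a : A ⟶ F ⋆ X) (b : F ⋆ Y ⟶ B), t = a ≫ actLeft F u ≫ b}
  comp_mem {A B C} f {g} hg := by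
    have : Submodule.span k {t | ∃ (F : S) (a : B ⟶ F ⋆ X) (b : F ⋆ Y ⟶ C),
        t = a ≫ actLeft F u ≫ b} ≤ (Submodule.span k {t | ∃ (F : S) (a : A ⟶ F ⋆ X)
          (b : F ⋆ Y ⟶ C), t = a ≫ actLeft F u ≫ b}).comap (Linear.leftComp k C f) := by
      rw [Submodule.span_le]
      rintro _ ⟨F, a, b, rfl⟩
      exact Submodule.subset_span ⟨F, f ≫ a, b, by simp⟩
    exact this hg
  mem_comp {A B C f} g hf := by
    have : Submodule.span k {t | ∃ (F : S) (a : A ⟶ F ⋆ X) (b : F ⋆ Y ⟶ B),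
        t = a ≫ actLeft F u ≫ b} ≤ (Submodule.span k {t | ∃ (F : S) (a : A ⟶ F ⋆ X)
          (b : F ⋆ Y ⟶ C), t = a ≫ actLeft F u ≫ b}).comap (Linear.rightComp k A g) := by
      rw [Submodule.span_le]
      rintro _ ⟨F, a, b, rfl⟩
      exact Submodule.subset_span ⟨F, a, b ≫ g, by simp⟩
    exact this hf
  act_mem G {A B f} hf := by
    have := (actFunctor_additive k M G).1
    have := (actFunctor_additive k M G).2
    have : Submodule.span k {t | ∃ (F : S) (a : A ⟶ F ⋆ X) (b : F ⋆ Y ⟶ B),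
        t = a ≫ actLeft F u ≫ b} ≤ (Submodule.span k {t | ∃ (F : S) (a : G ⋆ A ⟶ F ⋆ X)
          (b : F ⋆ Y ⟶ G ⋆ B), t = a ≫ actLeft F u ≫ b}).comap
            ((actFunctor M G).mapLinearMap k) := by
      rw [Submodule.span_le]
      rintro _ ⟨F, a, b, rfl⟩
      -- Stability holds because acting by `G` after `F` is acting by `G ⊠ F`, up to `mult`.
      refine Submodule.subset_span ⟨G ⊠ F, actLeft G a ≫ (mult G F X).inv,
        (mult G F Y).hom ≫ actLeft G b, ?_⟩
      change actLeft G (a ≫ actLeft F u ≫ b) = _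
      rw [actLeft_comp, actLeft_comp, actLeft_actLeft]
      simp only [Category.assoc]
    exact this hf

end Action

/-! ### Regularity of the action on morphisms -/

section Regularity

lemma SplitsOff.exists_multiples {C : Type u} [Category.{v} C] [Preadditive C] {X Y : C}
    {ι : Type*} (h : SplitsOff (𝟙 Y) fun _ : ι => X) : ∃ (a : ι → (X ⟶ Y)) (b : ι → (Y ⟶ X)),
      (∀ i, a i ≫ b i = 𝟙 X) ∧ ∀ i j, i ≠ j → a i ≫ b j = 0 := by
  obtain ⟨a, b, h1, h2⟩ := h
  exact ⟨a, b, fun i => by simpa using h1 i, fun i j hij => by simpa using h2 i j hij⟩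

variable (k : Type w) [Field k] {S : Type u₁} [Category.{v₁} S] [Preadditive S] [Linear k S]
  [SemigroupCategory S] [SemigroupCategory.IsLinear k S] {M : Type u} [Category.{v} M]
  [Preadditive M] [Linear k M] [ModuleCategory S M] [ModuleCategory.IsLinear k S M]

/-- In a simple transitive module category with nonzero action, every morphism factors through the
image of any given nonzero morphism, up to sums. -/
lemma IsSimpleTransitive.mem_span (hM : IsSimpleTransitive k S M) {γ : S}
    (hγ : ∀ X : S, ∃ (n : ℕ) (a : Fin n → (X ⟶ γ)) (b : Fin n → (γ ⟶ X)), ∑ i, a i ≫ b i = 𝟙 X)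
    (hne : ∃ (F : S) (X Y : M) (f : X ⟶ Y), actLeft F f ≠ 0) {X Y : M} {u : X ⟶ Y} (hu : u ≠ 0)
    {A B : M} (t : A ⟶ B) :
    t ∈ Submodule.span k {t | ∃ (a : A ⟶ γ ⋆ X) (b : γ ⋆ Y ⟶ B), t = a ≫ actLeft γ u ≫ b} := by
  -- Without a unit, `u` need not lie in the ideal generated by its images, and that ideal might
  -- vanish. The annihilator ideal excludes this: it is not everything since the action is nonzero,
  -- so it is zero and cannot contain `u`.
  have h1 : ∃ F : S, actLeft F u ≠ 0 := by
    by_contra! h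
    rcases hM (annihilatorIdeal S M k) with h0 | h0
    · have : u ∈ (annihilatorIdeal S M k).hom X Y := (mem_annihilatorIdeal k u).2 h
      rw [h0] at this
      exact hu this
    · obtain ⟨F, X', Y', f, hf⟩ := hne
      have : f ∈ (annihilatorIdeal S M k).hom X' Y' := by rw [h0]; trivial
      exact hf ((mem_annihilatorIdeal k f).1 this F)
  obtain ⟨F, hF⟩ := h1
  have h2 : t ∈ (generatedIdeal S k u).hom A B := by
    rcases hM (generatedIdeal S k u) with h0 | h0
    · have : actLeft F u ∈ (generatedIdeal S k u).hom (F ⋆ X) (F ⋆ Y) :=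
        Submodule.subset_span ⟨F, 𝟙 _, 𝟙 _, by simp⟩
      rw [h0] at this
      exact (hF this).elim
    · rw [h0]; trivial
  refine (Submodule.span_le.2 ?_ : Submodule.span k _ ≤ _) h2
  rintro _ ⟨F, a, b, rfl⟩
  -- `F` is a summand of copies of `γ`, so by naturality a factorization through `F ⋆ u` is a sum of
  -- factorizations through `γ ⋆ u`.
  obtain ⟨n, c, d, hcd⟩ := hγ F
  have := actOnFunctor_additive (S := S) k X
  have h3 : ∑ i, actRight (c i) X ≫ actRight (d i) X = 𝟙 (F ⋆ X) := by
    have := congrArg (actOnFunctor X).map hcd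
    rw [(actOnFunctor X).map_sum, (actOnFunctor X).map_id] at this
    simp only [← actRight_comp]
    exact this
  have h4 : a ≫ actLeft F u ≫ b =
      ∑ i, (a ≫ actRight (c i) X) ≫ actLeft γ u ≫ actRight (d i) Y ≫ b := by
    have h5 : ∀ i, (a ≫ actRight (c i) X) ≫ actLeft γ u ≫ actRight (d i) Y ≫ b =
        a ≫ (actRight (c i) X ≫ actRight (d i) X) ≫ actLeft F u ≫ b := fun i => by
      rw [← Category.assoc (actLeft γ u), act_exchange]
      simp only [Category.assoc]
    rw [Finset.sum_congr rfl fun i _ => h5 i, ← Preadditive.comp_sum, ← Preadditive.sum_comp, h3,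
      Category.id_comp]
  rw [h4]
  exact Submodule.sum_mem _ fun i _ => Submodule.subset_span ⟨_, _, rfl⟩

/-- In a J-cell-trivial category, an additive generator factors through `Θ ⊠ (I ⊠ Θ)` for every
nonzero `I`, if `Θ` is a large enough multiple of the generator. -/
lemma IsJCellTrivial.exists_factorization (hS : IsJCellTrivial S) {γ : S}
    (hγ : ∀ X : S, ∃ (n : ℕ) (a : Fin n → (X ⟶ γ)) (b : Fin n → (γ ⟶ X)), ∑ i, a i ≫ b i = 𝟙 X)
    [Module.Finite k (γ ⟶ γ)] {D : ℕ} (hD : Module.finrank k (γ ⟶ γ) ≤ D) {Θ : S}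
    (hΘ : SplitsOff (𝟙 Θ) fun _ : Fin (D + 1) => γ) {I : S} (hI : 𝟙 I ≠ 0) :
    ∃ (s : γ ⟶ Θ ⊠ (I ⊠ Θ)) (r : Θ ⊠ (I ⊠ Θ) ⟶ γ), s ≫ r = 𝟙 γ := by
  obtain ⟨H, K, ⟨ρ⟩⟩ := hS γ I fun h => hI (h.eq_of_src _ _)
  have hR := fun Z : S => tensorRightFunctor_additive k Z
  have hL := fun Z : S => tensorLeftFunctor_additive k Z
  -- Replace first `H` and then `K` by the generator, at the cost of passing to sums.
  have h1 : 𝟙 γ ∈ Submodule.span k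
      {t | ∃ (p : γ ⟶ γ ⊠ (I ⊠ γ)) (q : γ ⊠ (I ⊠ γ) ⟶ γ), t = p ≫ q} := by
    rw [← ρ.retract]
    refine (Submodule.span_le.2 ?_ : Submodule.span k _ ≤ _) (comp_mem_span_of_generator k hγ
      (tensorRightFunctor (I ⊠ K)) (X := H) ρ.i ρ.r)
    rintro _ ⟨p, q, rfl⟩
    exact comp_mem_span_of_generator k hγ (tensorLeftFunctor I ⋙ tensorLeftFunctor γ) (X := K) p q
  -- The number of terms is bounded by `dim End γ`, independently of `I`, so one multiple `Θ` works
  -- for all `I`.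
  obtain ⟨y, hy, hsum⟩ := exists_sum_of_mem_span (D := D + 1)
    (fun r v hv => by
      obtain ⟨p, q, rfl⟩ := hv
      exact ⟨p, r • q, (Linear.comp_smul ..).symm⟩)
    (by exact ⟨0, 0, by simp⟩) h1 (by omega)
  choose p q hpq using hy
  simp only [hpq] at hsum
  obtain ⟨p', q', hpq'⟩ : ∃ (p' : γ ⟶ Θ ⊠ (I ⊠ γ)) (q' : Θ ⊠ (I ⊠ γ) ⟶ γ), p' ≫ q' = 𝟙 γ :=
    exists_factorization_of_sum hΘ (tensorRightFunctor (I ⊠ γ)) p q hsum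
  obtain ⟨a, b, hab, -⟩ := hΘ.exists_multiples
  -- The left factor `Θ` absorbs the sum; on the right a single copy of `γ` in `Θ` suffices. It
  -- exists even for `D = 0`, since there are `D + 1` copies.
  refine ⟨p' ≫ Θ ◁ₛ (I ◁ₛ a 0), Θ ◁ₛ (I ◁ₛ b 0) ≫ q', ?_⟩
  rw [Category.assoc, ← Category.assoc (Θ ◁ₛ _), ← whiskerLeft_comp, ← whiskerLeft_comp, hab,
    whiskerLeft_id, whiskerLeft_id, Category.id_comp, hpq']

/-- The tensor powers of an object. -/
def tensorPower (Θ : S) : ℕ → S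
  | 0 => Θ
  | n + 1 => Θ ⊠ tensorPower Θ n

variable (M) in
/-- The tensor powers of `Θ` act by the iterates of the action of `Θ`. -/
def actTensorPowerIso (Θ : S) :
    ∀ n, actFunctor M (tensorPower Θ n) ≅ iterFunctor (actFunctor M Θ) (n + 1)
  | 0 => (Functor.leftUnitor _).symm
  | n + 1 => actMultIso Θ (tensorPower Θ n) ≪≫
      Functor.isoWhiskerRight (actTensorPowerIso Θ n) (actFunctor M Θ)

variable (M) in
/-- The action of `Θ ⊠ (Θ ^ (n + 1) ⊠ Θ)`. -/
def actTensorPowerIso' (Θ : S) (n : ℕ) : actFunctor M (Θ ⊠ (tensorPower Θ n ⊠ Θ)) ≅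
    actFunctor M Θ ⋙ iterFunctor (actFunctor M Θ) (n + 2) :=
  actMultIso Θ (tensorPower Θ n ⊠ Θ) ≪≫
    Functor.isoWhiskerRight (actMultIso (tensorPower Θ n) Θ ≪≫
      Functor.isoWhiskerLeft (actFunctor M Θ) (actTensorPowerIso M Θ n)) (actFunctor M Θ)

/-- If `S` is J-cell-trivial and `M` is simple transitive, then the objects of `S` send all
morphisms of `M` to regular morphisms. -/
theorem isRegularHom_actLeft [IsFinitary k S] [IsFinitary k M] (hS : IsJCellTrivial S)
    (hM : IsSimpleTransitive k S M) (F : S) {X Y : M} (f : X ⟶ Y) : IsRegularHom (actLeft F f) := by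
  classical
  by_cases hne : ∃ (F : S) (X Y : M) (f : X ⟶ Y), actLeft F f ≠ 0
  swap
  · push Not at hne
    rw [hne]
    exact isRegularHom_zero _ _
  obtain ⟨g, hMfin, hg⟩ := IsFinitary.exists_generator k M
  obtain ⟨γ, hSfin, hγ⟩ := IsFinitary.exists_generator k S
  have hg0 : 𝟙 g ≠ 0 := by
    intro h0
    obtain ⟨F, X, Y, f, hf⟩ := hne
    obtain ⟨n, a, b, hab⟩ := hg (F ⋆ X)
    apply hf
    rw [← Category.id_comp (actLeft F f), ← hab, Finset.sum_eq_zero fun i _ => ?_,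
      Limits.zero_comp]
    rw [← Category.id_comp (b i), h0, Limits.zero_comp, Limits.comp_zero]
  -- The two dimensions bound the number of terms needed to write `𝟙 γ` through `γ ⊠ (I ⊠ γ)` and `𝟙
  -- g` through `γ ⋆ u`.
  let D := max (Module.finrank k (γ ⟶ γ)) (Module.finrank k (g ⟶ g))
  obtain ⟨Θ, hΘ⟩ := IsFinitary.exists_power k γ (D + 1)
  have hadd := fun F : S => (actFunctor_additive k M F).1
  have hlin := fun F : S => (actFunctor_additive k M F).2
  have hact := fun X : M => actOnFunctor_additive (S := S) k X
  have hT : ∀ {X Y : M} (u : X ⟶ Y), u ≠ 0 → ∃ (a : g ⟶ (actFunctor M Θ).obj X)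
      (b : (actFunctor M Θ).obj Y ⟶ g), a ≫ (actFunctor M Θ).map u ≫ b = 𝟙 g := by
    intro X Y u hu
    obtain ⟨y, hy, hsum⟩ := exists_sum_of_mem_span (D := D + 1)
      (fun r v hv => by
        obtain ⟨p, q, rfl⟩ := hv
        exact ⟨p, r • q, by rw [Linear.comp_smul, Linear.comp_smul]⟩)
      (by exact ⟨0, 0, by simp⟩) (hM.mem_span k hγ hne hu (𝟙 g)) (by omega)
    choose p q hpq using hy
    have hsum' : ∑ i, p i ≫ (actLeft γ u ≫ q i) = 𝟙 g := by
      rw [← hsum]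
      exact Finset.sum_congr rfl fun i _ => (hpq i).symm
    obtain ⟨a, b, h1, h2⟩ := hΘ.exists_multiples
    -- The `i`-th term of the sum for `𝟙 g` is routed through the `i`-th copy of `γ` in `Θ`;
    -- orthogonality of the copies kills the cross terms.
    refine ⟨∑ i, p i ≫ actRight (a i) X, ∑ j, actRight (b j) Y ≫ q j, ?_⟩
    change (∑ i, p i ≫ actRight (a i) X) ≫ actLeft Θ u ≫ (∑ j, actRight (b j) Y ≫ q j) = 𝟙 g
    have h3 : ∀ i j, actRight (a i) X ≫ actLeft Θ u ≫ actRight (b j) Y ≫ q j =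
        actRight (a i ≫ b j) X ≫ actLeft γ u ≫ q j := by
      intro i j
      rw [← Category.assoc (actLeft Θ u), act_exchange, actRight_comp]
      simp only [Category.assoc]
    rw [Preadditive.sum_comp, ← hsum']
    refine Finset.sum_congr rfl fun i _ => ?_
    rw [Preadditive.comp_sum, Category.assoc, Preadditive.comp_sum, Finset.sum_eq_single i]
    · rw [h3, h1, actRight_id, Category.id_comp]
    · intro j _ hij
      have : actRight (0 : γ ⟶ γ) X = 0 := (actOnFunctor X).map_zero _ _
      rw [h3, h2 i j hij.symm, this, Limits.zero_comp]
    · simp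
  obtain ⟨α, hα⟩ := IsFinitary.exists_decomposition k S
  have hregγ : ∀ {X Y : M} (f : X ⟶ Y), IsRegularHom (actLeft γ f) := by
    intro X Y f
    refine isRegularHom_map_of_growth k (actFunctor M Θ) (actFunctor M γ) hg hg0 hT
      (Module.finrank k (g ⟶ α ⋆ g)) (fun n => ?_) f
    -- Each nonzero summand `I i` of the tensor power gives one copy of `γ` in `Θ ⊠ (I i ⊠ Θ)`, and
    -- these copies are orthogonal. As `I i` is a summand of `α`, it contributes at most `dim Hom(g,
    -- α ⋆ g)` to `dim Hom(g, T ^ (n + 1) g)`, so the number `q` of summands grows at least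
    -- proportionally to that dimension.
    obtain ⟨q, I, a, b, hI, hIα, h1, h2, hsum⟩ := hα (tensorPower Θ n)
    choose s r hsr using fun i => hS.exists_factorization k hγ (le_max_left _ _) hΘ (hI i)
    have := tensorRightFunctor_additive k Θ
    have := tensorLeftFunctor_additive k Θ
    let ξ := actTensorPowerIso' M Θ n
    have key : ∀ i j, (actTrans (s i ≫ Θ ◁ₛ (a i ▷ₛ Θ)) ≫ ξ.hom) ≫
        (ξ.inv ≫ actTrans (Θ ◁ₛ (b j ▷ₛ Θ) ≫ r j)) =
        actTrans (M := M) (s i ≫ Θ ◁ₛ ((a i ≫ b j) ▷ₛ Θ) ≫ r j) := by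
      intro i j
      rw [Category.assoc, Iso.hom_inv_id_assoc, ← actTrans_comp, comp_whiskerRight,
        whiskerLeft_comp]
      simp only [Category.assoc]
    have hzero : ∀ i j, Θ ◁ₛ ((0 : I i ⟶ I j) ▷ₛ Θ) = 0 := fun i j =>
      (tensorRightFunctor Θ ⋙ tensorLeftFunctor Θ).map_zero _ _
    refine ⟨q, fun i => actTrans (s i ≫ Θ ◁ₛ (a i ▷ₛ Θ)) ≫ ξ.hom,
      fun i => ξ.inv ≫ actTrans (Θ ◁ₛ (b i ▷ₛ Θ) ≫ r i), ?_, fun i => ?_, fun i j hij => ?_⟩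
    · have e1 := finrank_hom_map_le_sum k (actOnFunctor g) a b hsum g
      have e2 : ∀ i, Module.finrank k (g ⟶ (actOnFunctor g).obj (I i)) ≤
          Module.finrank k (g ⟶ α ⋆ g) := fun i =>
        finrank_hom_le_of_retract k ((hIα i).some.map (actOnFunctor g)) g
      have e3 := finrank_hom_le_of_retract k
        (Retract.ofIso ((actTensorPowerIso M Θ n).app g).symm) g
      refine e3.trans (e1.trans ((Finset.sum_le_sum fun i _ => e2 i).trans_eq ?_))
      simp [mul_comm]
    · rw [key, h1, id_whiskerRight, whiskerLeft_id, Category.id_comp, hsr, actTrans_id]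
    · rw [key, h2 i j hij, hzero, Limits.zero_comp, Limits.comp_zero, actTrans_zero k]
  -- Regularity descends from `γ` to `F`, a summand of copies of `γ`.
  obtain ⟨n, c, d, hcd⟩ := hγ F
  refine (hregγ f).of_sum_retract (fun l => actRight (c l) X) (fun l => actRight (d l) X)
    (fun l => actRight (c l) Y) (fun l => actRight (d l) Y) (fun l => (act_exchange _ _).symm)
    (fun l => act_exchange _ _) ?_
  have := congrArg (actOnFunctor X).map hcd
  rw [(actOnFunctor X).map_sum, (actOnFunctor X).map_id] at this
  simp only [← actRight_comp]
  exact this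

end Regularity

/-! ### Linear presheaves form an abelian category -/

section PresheafAbelian

variable (k : Type w) [Field k] (M : Type u) [Category.{v} M] [Preadditive M] [Linear k M]

/-- Additivity and linearity are equations between maps, and these can be checked after composing
with the componentwise monomorphisms. Dually for quotients; for finite products the projections
serve, evaluated at each object. -/
instance : (IsLinearPresheaf k M).IsClosedUnderSubobjects where
  prop_of_mono {Φ Ψ} α _ h := by
    have h1 := h.1
    have hα : ∀ {X Y} (f g : Φ.obj X ⟶ Φ.obj Y),
        f ≫ α.app Y = g ≫ α.app Y → f = g := fun f g hfg => (cancel_mono _).1 hfg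
    refine ⟨⟨fun {X Y f g} => hα _ _ ?_⟩, fun r X Y f => hα _ _ ?_⟩
    · simp [Functor.map_add]
    · rw [α.naturality, h.2, Linear.comp_smul, Linear.smul_comp, α.naturality]

instance : (IsLinearPresheaf k M).IsClosedUnderQuotients where
  prop_of_epi {Φ Ψ} α _ h := by
    have h1 := h.1
    have hα : ∀ {X Y} (f g : Ψ.obj X ⟶ Ψ.obj Y),
        α.app X ≫ f = α.app X ≫ g → f = g := fun f g hfg => (cancel_epi _).1 hfg
    refine ⟨⟨fun {X Y f g} => hα _ _ ?_⟩, fun r X Y f => hα _ _ ?_⟩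
    · simp only [← α.naturality, Functor.map_add, Preadditive.add_comp, Preadditive.comp_add]
    · rw [← α.naturality, h.2, Linear.comp_smul, Linear.smul_comp, α.naturality]

instance : (IsLinearPresheaf k M).IsClosedUnderFiniteProducts where
  isClosedUnderLimitsOfShape J _ := by
    refine ⟨?_⟩
    rintro Φ ⟨h⟩
    have hadd := fun j => (h.prop_diag_obj j).1
    have hext : ∀ {W} {X : Mᵒᵖ} (f g : W ⟶ Φ.obj X),
        (∀ j, f ≫ (h.π.app j).app X = g ≫ (h.π.app j).app X) → f = g := fun {W X} f g hfg =>
      (Limits.isLimitOfPreserves ((evaluation _ _).obj X) h.isLimit).hom_ext hfg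
    refine ⟨⟨fun {X Y f g} => hext _ _ fun j => ?_⟩, fun r X Y f => hext _ _ fun j => ?_⟩
    · have n := fun f : X ⟶ Y => (h.π.app j).naturality f
      simp only [Functor.const_obj_obj] at n
      rw [Preadditive.add_comp, n, n, n, Functor.map_add, Preadditive.comp_add]
    · have n := fun f : Opposite.op Y ⟶ Opposite.op X => (h.π.app j).naturality f
      simp only [Functor.const_obj_obj] at n
      rw [Linear.smul_comp, n, n, (h.prop_diag_obj j).2, Linear.comp_smul]

instance : (IsLinearPresheaf k M).ContainsZero where
  exists_zero := by
    obtain ⟨Z, h⟩ := (inferInstance : Limits.HasZeroObject (Mᵒᵖ ⥤ FGModuleCat.{v} k)).zero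
    exact ⟨Z, h, ⟨fun {X Y f g} => (h.obj X).eq_of_src _ _⟩,
      fun r X Y f => (h.obj _).eq_of_src _ _⟩

noncomputable instance : Abelian (FinPresheaf k M) := inferInstance

end PresheafAbelian

/-! ### Representable presheaves and enough projectives -/

section Representable

variable {k : Type w} [Field k] {M : Type u} [Category.{v} M] [Preadditive M] [Linear k M]

/-- Epimorphisms survive the inclusion into all presheaves, and there they can be tested
componentwise. -/
lemma FinPresheaf.surjective_app_of_epi {Φ Ψ : FinPresheaf k M} (β : Φ ⟶ Ψ) [Epi β] (X : M) :
    Function.Surjective (app β X) := by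
  have := (IsLinearPresheaf k M).preservesEpimorphisms_ι_of_isNormalMonoCategory
  have h1 : Epi β.hom := inferInstanceAs (Epi ((IsLinearPresheaf k M).ι.map β))
  have h2 : Epi (β.hom.app (Opposite.op X)) := inferInstance
  have h3 : Epi ((forget₂ (FGModuleCat k) (ModuleCat k)).map (β.hom.app (Opposite.op X))) :=
    inferInstance
  exact (ModuleCat.epi_iff_surjective _).1 h3

lemma FinPresheaf.epi_of_surjective {Φ Ψ : FinPresheaf k M} (β : Φ ⟶ Ψ)
    (hβ : ∀ X, Function.Surjective (app β X)) : Epi β where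
  left_cancellation γ δ h := hom_ext fun X x => by
    obtain ⟨x, rfl⟩ := hβ X x
    exact congrArg (fun t => app t X x) h

/-- The action of morphisms on an element of a presheaf. -/
def FinPresheaf.pullₗ (Φ : FinPresheaf k M) {Y : M} (y : Φ.val Y) (X : M) :
    (X ⟶ Y) →ₗ[k] Φ.val X where
  toFun f := Φ.pull f y
  map_add' f g := Φ.pull_add f g y
  map_smul' r f := Φ.pull_smul r f y

lemma FinPresheaf.pullₗ_apply (Φ : FinPresheaf k M) {X Y : M} (y : Φ.val Y) (f : X ⟶ Y) :
    Φ.pullₗ y X f = Φ.pull f y := rfl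

variable [∀ X Y : M, Module.Finite k (X ⟶ Y)]

variable (k) in
/-- The presheaf represented by an object. -/
def representable (X : M) : FinPresheaf k M :=
  FinPresheaf.mkObj (fun Y => Y ⟶ X) (fun {Y Z} => Linear.comp Y Z X)
    (fun _ x => Category.id_comp x) (fun f g z => Category.assoc f g z)

/-- A morphism, as an element of the represented presheaf. -/
def toRepresentable {X Y : M} : (Y ⟶ X) ≃ₗ[k] (representable k X).val Y := LinearEquiv.refl k _

lemma representable_pull {X Y Z : M} (f : Z ⟶ Y) (g : Y ⟶ X) :
    (representable k X).pull f (toRepresentable g) = toRepresentable (f ≫ g) := rfl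

/-- The morphism from a representable presheaf given by an element. -/
def representableLift {Φ : FinPresheaf k M} {X : M} (x : Φ.val X) : representable k X ⟶ Φ :=
  FinPresheaf.mkHom (fun Y => Φ.pullₗ x Y ∘ₗ (toRepresentable (k := k)).symm.toLinearMap)
    (fun f g => Φ.pull_comp f (toRepresentable.symm g) x)

lemma app_representableLift {Φ : FinPresheaf k M} {X Y : M} (x : Φ.val X) (f : Y ⟶ X) :
    FinPresheaf.app (representableLift x) Y (toRepresentable f) = Φ.pull f x := rfl

lemma representable_hom_ext {Φ : FinPresheaf k M} {X : M} {β γ : representable k X ⟶ Φ}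
    (h : FinPresheaf.app β X (toRepresentable (𝟙 X)) =
      FinPresheaf.app γ X (toRepresentable (𝟙 X))) : β = γ := by
  refine FinPresheaf.hom_ext fun Y y => ?_
  obtain ⟨f, rfl⟩ := (toRepresentable (k := k)).surjective y
  have hf : toRepresentable f = (representable k X).pull f (toRepresentable (𝟙 X)) := by
    rw [representable_pull, Category.comp_id]
  rw [hf, FinPresheaf.app_pull, FinPresheaf.app_pull, h]

/-- By Yoneda, the lifting problem amounts to lifting one element along the surjection at `X`. -/
instance representable_projective (X : M) : Projective (representable k X) where
  factors {Φ Ψ} f e _ := by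
    obtain ⟨z, hz⟩ := FinPresheaf.surjective_app_of_epi e X
      (FinPresheaf.app f X (toRepresentable (𝟙 X)))
    refine ⟨representableLift z, representable_hom_ext ?_⟩
    change FinPresheaf.app e X (Φ.pull (𝟙 X) z) = _
    rw [FinPresheaf.pull_id, hz]

/-- Over a finitary category, every presheaf is a quotient of a representable one. -/
lemma exists_epi_representable [IsFinitary k M] (Φ : FinPresheaf k M) :
    ∃ (Y : M) (p : representable k Y ⟶ Φ), Epi p := by
  obtain ⟨g, -, hg⟩ := IsFinitary.exists_generator k M
  let v := Module.finBasis k (Φ.val g)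
  obtain ⟨Y, hY⟩ := IsFinitary.exists_power k g (Module.finrank k (Φ.val g))
  obtain ⟨a, b, h1, h2⟩ := hY.exists_multiples
  -- The basis of `Φ(g)`, bundled into one element over a multiple of `g`. Pulling it back along the
  -- inclusions recovers the basis, which generates `Φ` because `g` generates `M`.
  let ξ : Φ.val Y := ∑ i, Φ.pull (b i) (v i)
  have hξ : ∀ j, Φ.pull (a j) ξ = v j := fun j => by
    rw [map_sum, Finset.sum_eq_single j]
    · rw [← Φ.pull_comp, h1, Φ.pull_id]
    · intro i _ hij
      rw [← Φ.pull_comp, h2 j i hij.symm]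
      exact (Φ.pullₗ (v i) g).map_zero
    · simp
  refine ⟨Y, representableLift ξ, FinPresheaf.epi_of_surjective _ fun Z z => ?_⟩
  suffices h : z ∈ LinearMap.range (Φ.pullₗ ξ Z) by
    obtain ⟨f, hf⟩ := h
    exact ⟨toRepresentable f, hf⟩
  obtain ⟨n, s, t, hst⟩ := hg Z
  have hz : z = ∑ l, Φ.pull (s l) (Φ.pull (t l) z) := by
    conv_lhs => rw [← Φ.pull_id Z z, ← Φ.pullₗ_apply, ← hst, map_sum]
    exact Finset.sum_congr rfl fun l _ => Φ.pull_comp _ _ _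
  rw [hz]
  refine Submodule.sum_mem _ fun l _ => ?_
  rw [← v.sum_repr (Φ.pull (t l) z), map_sum]
  refine Submodule.sum_mem _ fun i _ => ?_
  rw [map_smul]
  refine Submodule.smul_mem _ _ ⟨s l ≫ a i, ?_⟩
  rw [Φ.pullₗ_apply, Φ.pull_comp, hξ]

end Representable

/-! ### From regular morphisms to projective presheaves -/

section Projectivizing

variable {k : Type w} [Field k] {S : Type u₁} [Category.{v₁} S] [Preadditive S] [Linear k S]
  [SemigroupCategory S] {M : Type u} [Category.{v} M] [Preadditive M] [Linear k M]
  [ModuleCategory S M] [ModuleCategory.IsLinear k S M] [IsFinitary k M]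
  [∀ X Y : M, Module.Finite k (X ⟶ Y)]

variable (k) in
/-- The universal element of `F ⋆ Hom(-, X)`. -/
noncomputable def actRepresentableElt (F : S) (X : M) :
    ((actExtension k M F).obj (representable k X)).val (F ⋆ X) :=
  actUnit k F (representable k X) X (toRepresentable (𝟙 X))

/-- The universal element of `F ⋆ Hom(-, X)` plays the role of `𝟙 (F ⋆ X)`. This and the next lemma
are the parts of `F ⋆ Hom(-, X) ≅ Hom(-, F ⋆ X)` that the argument needs, so the isomorphism itself
is never constructed. -/
lemma actRepresentable_hom_ext {F : S} {X : M} {Ψ : FinPresheaf k M}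
    {β γ : (actExtension k M F).obj (representable k X) ⟶ Ψ}
    (h : FinPresheaf.app β (F ⋆ X) (actRepresentableElt k F X) =
      FinPresheaf.app γ (F ⋆ X) (actRepresentableElt k F X)) : β = γ := by
  refine actExtension_hom_ext fun Z z => ?_
  obtain ⟨f, rfl⟩ := (toRepresentable (k := k)).surjective z
  have hf : toRepresentable f = (representable k X).pull f (toRepresentable (𝟙 X)) := by
    rw [representable_pull, Category.comp_id]
  rw [hf, actUnit_pull, FinPresheaf.app_pull, FinPresheaf.app_pull]
  exact congrArg _ h

/-- A morphism `F ⋆ X ⟶ F ⋆ Y` induces a morphism `F ⋆ Hom(-, X) ⟶ F ⋆ Hom(-, Y)`. -/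
lemma exists_actRepresentable_hom {F : S} {X Y : M} (t : F ⋆ X ⟶ F ⋆ Y) :
    ∃ β : (actExtension k M F).obj (representable k X) ⟶
      (actExtension k M F).obj (representable k Y),
      FinPresheaf.app β (F ⋆ X) (actRepresentableElt k F X) =
        ((actExtension k M F).obj (representable k Y)).pull t (actRepresentableElt k F Y) := by
  let z : ((actRestriction k M F).obj ((actExtension k M F).obj (representable k Y))).val X :=
    ((actExtension k M F).obj (representable k Y)).pull t (actRepresentableElt k F Y)
  refine ⟨((actExtensionAdj k M F).homEquiv _ _).symm (representableLift z), ?_⟩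
  have h := ((actExtensionAdj k M F).homEquiv _ _).apply_symm_apply (representableLift z)
  rw [Adjunction.homEquiv_unit] at h
  refine (congrArg (fun β => FinPresheaf.app β X (toRepresentable (𝟙 X))) h).trans ?_
  exact (app_representableLift z (𝟙 X)).trans (FinPresheaf.pull_id _ X z)

lemma app_actExtension_map_representable {F : S} {X Y : M}
    (d : representable k X ⟶ representable k Y) {f : X ⟶ Y}
    (hf : FinPresheaf.app d X (toRepresentable (𝟙 X)) = toRepresentable f) :
    FinPresheaf.app ((actExtension k M F).map d) (F ⋆ X) (actRepresentableElt k F X) =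
      ((actExtension k M F).obj (representable k Y)).pull (actLeft F f)
        (actRepresentableElt k F Y) := by
  rw [actRepresentableElt, app_actExtension_map, hf, actRepresentableElt, ← actUnit_pull,
    representable_pull, Category.comp_id]

/-- By Yoneda `d` comes from some `f : X ⟶ Y`. A generalized inverse of `F ⋆ f` induces one of `F ⋆
d`, as evaluation at the universal element shows. -/
lemma isRegularHom_actExtension_map {F : S}
    (hF : ∀ {X Y : M} (f : X ⟶ Y), IsRegularHom (actLeft F f)) {X Y : M}
    (d : representable k X ⟶ representable k Y) :
    IsRegularHom ((actExtension k M F).map d) := by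
  obtain ⟨f, hf⟩ := (toRepresentable (k := k)).surjective
    (FinPresheaf.app d X (toRepresentable (𝟙 X)))
  obtain ⟨q, hq⟩ := hF f
  obtain ⟨β, hβ⟩ := exists_actRepresentable_hom (k := k) q
  refine ⟨β, actRepresentable_hom_ext ?_⟩
  rw [FinPresheaf.app_comp, FinPresheaf.app_comp, app_actExtension_map_representable d hf.symm,
    FinPresheaf.app_pull, hβ, FinPresheaf.app_pull, FinPresheaf.app_pull,
    app_actExtension_map_representable d hf.symm, ← FinPresheaf.pull_comp,
    ← FinPresheaf.pull_comp, Category.assoc, hq]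

/-- The value of the restriction at `X` is the value at `F ⋆ X`, so surjectivity persists.
Consequently the left adjoint preserves projectives. -/
instance actRestriction_preservesEpimorphisms (F : S) :
    (actRestriction k M F).PreservesEpimorphisms where
  preserves β _ := FinPresheaf.epi_of_surjective _ fun X =>
    FinPresheaf.surjective_app_of_epi β (F ⋆ X)

/-- If `F` sends all morphisms of `M` to regular morphisms, then it sends all presheaves to
projective ones. -/
theorem projective_actExtension_obj {F : S}
    (hF : ∀ {X Y : M} (f : X ⟶ Y), IsRegularHom (actLeft F f)) (Φ : FinPresheaf k M) :
    Projective ((actExtension k M F).obj Φ) := by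
  obtain ⟨Y, p, _⟩ := exists_epi_representable Φ
  obtain ⟨X, p', _⟩ := exists_epi_representable (Limits.kernel p)
  set d := p' ≫ Limits.kernel.ι p with hd
  have hdp : d ≫ p = 0 := by rw [hd, Category.assoc, Limits.kernel.condition, Limits.comp_zero]
  let T := actExtension k M F
  let adj := actExtensionAdj k M F
  have hzero : ∀ Φ Ψ : FinPresheaf k M, T.map (0 : Φ ⟶ Ψ) = 0 := fun Φ Ψ => by
    have h := actExtension_map_add (k := k) (M := M) F (0 : Φ ⟶ Ψ) 0
    rw [add_zero] at h
    exact left_eq_add.1 h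
  obtain ⟨q, hq⟩ : ∃ q, T.map d ≫ q ≫ T.map d = T.map d := isRegularHom_actExtension_map hF d
  -- Regularity makes `e` vanish on the image of `T.map d` while inducing the identity on `T.obj Φ`.
  -- It therefore descends to a section of `T.map p`.
  let e : T.obj (representable k Y) ⟶ T.obj (representable k Y) := 𝟙 _ - q ≫ T.map d
  have hde : T.map d ≫ e = 0 := by
    simp only [e, Preadditive.comp_sub, hq, Category.comp_id, sub_self]
  have hep : e ≫ T.map p = T.map p := by
    simp only [e, Preadditive.sub_comp, Category.assoc, ← T.map_comp, hdp, hzero,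
      Limits.comp_zero, sub_zero, Category.id_comp]
  -- The descent is carried out on the other side of the adjunction: the transpose of `e` kills `d`,
  -- hence the kernel of `p`, and so factors through `p`.
  have hd0 : d ≫ adj.homEquiv _ _ e = 0 := by
    rw [← Adjunction.homEquiv_naturality_left]
    change adj.homEquiv _ _ (T.map d ≫ e) = 0
    rw [hde, Adjunction.homEquiv_unit]
    exact FinPresheaf.hom_ext fun _ _ => rfl
  have hk : Limits.kernel.ι p ≫ adj.homEquiv _ _ e = 0 := by
    rw [← cancel_epi p', ← Category.assoc, Limits.comp_zero]
    exact hd0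
  obtain ⟨s₀, hs₀⟩ : ∃ s₀ : Φ ⟶ (actRestriction k M F).obj (T.obj (representable k Y)),
      p ≫ s₀ = adj.homEquiv _ _ e :=
    ⟨_, (Abelian.epiIsCokernelOfKernel _ (Limits.kernelIsKernel p)).fac
      (Limits.CokernelCofork.ofπ _ hk) Limits.WalkingParallelPair.one⟩
  let s : T.obj Φ ⟶ T.obj (representable k Y) := (adj.homEquiv _ _).symm s₀
  have hs : T.map p ≫ s = e := by
    change (actExtension k M F).map p ≫ (adj.homEquiv _ _).symm s₀ = e
    rw [← Adjunction.homEquiv_naturality_left_symm, hs₀, Equiv.symm_apply_apply]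
  have hT : T.IsLeftAdjoint := adj.isLeftAdjoint
  have : Epi (T.map p) := inferInstance
  have hsp : s ≫ T.map p = 𝟙 _ := by
    rw [← cancel_epi (T.map p), ← Category.assoc, hs, hep, Category.comp_id]
  have hP : Projective (T.obj (representable k Y)) := adj.map_projective _ inferInstance
  exact Retract.projective ⟨s, T.map p, hsp⟩

end Projectivizing

end SgCat

/-! ### The theorem -/

theorem theorem4p15 (k : Type w) [Field k] [IsAlgClosed k]
    (S : Type u₁) [Category.{v₁} S] [Preadditive S] [Linear k S]
    [SemigroupCategory S] [SemigroupCategory.IsLinear k S]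
    [IsQuasiFias k S] (hS : IsJCellTrivial S)
    (M : Type u) [Category.{v} M] [Preadditive M] [Linear k M]
    [ModuleCategory S M] [ModuleCategory.IsLinear k S M]
    [IsFinitary k M] (hM : IsSimpleTransitive k S M) :
    IsProjectivizing S (FinPresheaf k M) := by
  obtain ⟨g, hfin, -⟩ := IsFinitary.exists_generator k M
  refine ⟨⟨inferInstance⟩, ⟨fun Φ => ?_⟩, fun F Φ => ?_⟩
  · obtain ⟨Y, p, hp⟩ := exists_epi_representable Φ
    exact ⟨{ p := representable k Y, f := p }⟩
  · exact projective_actExtension_obj (fun f => isRegularHom_actLeft k hS hM F f) Φ
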